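/- \textbf{Setting.} Let $\mathsf X$ be a measurable space, $\pi_0$ a probability measure (prior) on $\mathsf X$, $L\ge 0$ a $\pi_0$-integrable likelihood, $f(\zeta)=\int \zeta L\,d\pi_0$, $Z=f(1)$ and $\pi(\varphi)=f(\varphi)/f(1)$. For $\alpha\in\mathbb Z_+^D$ let $L_\alpha\ge0$ be measurable approximate likelihoods and $f_\alpha(\zeta)=\int\zeta L_\alpha\,d\pi_0$; let $\varphi$ be a quantity of interest with $\varphi L\in L^1(\pi_0)$, with measurable approximations $\varphi_\alpha$ (the function $1$ is approximated by itself). Let $\Delta=\Delta_D\circ\cdots\circ\Delta_1$ be the mixed difference, $\Delta_i v_\alpha=v_\alpha-v_{\alpha-e_i}$ if $\alpha_i>0$ and $\Delta_i v_\alpha=v_\alpha$ if $\alpha_i=0$. For $S\subseteq\{1,\dots,D\}$ put $\alpha-1_S=\alpha-\sum_{i\in S}e_i$, where terms with a negative entry are zero ($L_{\alpha-1_S}:=0$). \textbf{SMC sampler.} On $\mathsf X^{2^D}$ (coordinates $x_S$) let $\Pi_0$ be the law of $(x,\dots,x)$, $x\sim\pi_0$, let $\mathbf L_\alpha(\mathbf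 x)=\max_S L_{\alpha-1_S}(x_S)$, and let $F_{\alpha,0},\dots,F_{\alpha,J}=\mathbf L_\alpha\Pi_0$ be measures with positive densities with respect to $\Pi_0$, $F_{\alpha,0}$ being a probability measure (e.g. $F_{\alpha,j}=\mathbf L_\alpha^{\tau_j}\Pi_0$, $0=\tau_0<\dots<\tau_J=1$). Put $H_{\alpha,j}=F_{\alpha,j+1}/F_{\alpha,j}$, and let $M_{\alpha,j}$ $(1\le j\le J)$ be Markov kernels leaving $F_{\alpha,j}$ invariant. A run with $n$ particles starts from $n$ i.i.d. draws of $F_{\alpha,0}$ and $Z^n=1$; for $j=0,\dots,J-1$ it multiplies $Z^n$ by the empirical mean of $H_{\alpha,j}$ over the particles, resamples the particles multinomially with weights proportional to $H_{\alpha,j}$, and moves each one independently by $M_{\alpha,j+1}$. With final particles $\mathbf x^1,\dots,\mathbf x^n$ put $F_\alpha^n(\psi)=Z^n\frac1n\sum_i\psi(\mathbf x^i)$. For $\zeta=(\zeta_\alpha)$ put $\psi_{\zeta_\alpha}(\mathbf x)=\sum_S(-1)^{|S|}\frac{L_{\alpha-1_S}(x_S)}{\mathbf L_\alpha(\mathbf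 x)}\zeta_{\alpha-1_S}(x_S)$. \textbf{Randomized estimator.} Fix an integer $N_{\min}\ge1$ and $0<Z_{\min}\le Z$. For a probability distribution $\mathbf p$ on $\mathbb Z_+^D$ and $N=mN_{\min}$, $m\ge1$, draw $\alpha_1,\dots,\alpha_m$ i.i.d. from $\mathbf p$, let $N_\alpha=N_{\min}\#\{i:\alpha_i=\alpha\}$, and given these run, for each $\alpha$, an independent SMC sampler with $N_\alpha$ particles. Put $$\widehat F^{\rm rMI}(\zeta)=\sum_\alpha\frac{N_\alpha}{Np_\alpha}F_\alpha^{N_\alpha}(\psi_{\zeta_\alpha}),\qquad \widehat\varphi^{\rm rMI}=\frac{\widehat F^{\rm rMI}(\varphi)}{\max\{\widehat F^{\rm rMI}(1),Z_{\min}\}},\qquad {\rm COST}(\widehat\varphi^{\rm rMI})=\sum_\alpha N_\alpha C_\alpha,$$ where $C_\alpha\ge0$ is the cost per particle at $\alpha$. \textbf{Theorem.} Assume: (G) there is $C>0$ with $C^{-1}<Z\le C$, and with $C^{-1}<h\le C$ on all of $\mathsf X^{2^D}$, for all $\alpha$, where $h$ is any of the functions $dF_{\alpha,0}/d\Pi_0$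 and $H_{\alpha,j}$, $0\le j<J$; (consistency, without rate) $f_\alpha(\varphi_\alpha)\to f(\varphi)$ and $f_\alpha(1)\to f(1)$ as $\min_i\alpha_i\to\infty$; and there are exponents $\beta_i>\gamma_i>0$, $i=1,\dots,D$, and $C>0$ such that for all $\alpha$ (V) $\int_{\mathsf X}(\Delta(L_\alpha\zeta_\alpha))^2\,d\pi_0\le C\prod_{i=1}^D2^{-\alpha_i\beta_i}$ both for $\zeta_\alpha=\varphi_\alpha$ and for $\zeta_\alpha=1$; (C) $C_\alpha\le C\prod_{i=1}^D2^{\alpha_i\gamma_i}$ (in particular if $C_\alpha\propto\prod_{i=1}^D2^{\alpha_i\gamma_i}$). Then for the probability distribution $p_\alpha\propto\prod_{i=1}^D2^{-\alpha_i(\gamma_i+\beta_i)/2}$ on $\mathbb Z_+^D$ there is $C>0$ such that for all $N=mN_{\min}$, $m\ge1$, $$\mathbb E\big[(\widehat\varphi^{\rm rMI}-\pi(\varphi))^2\big]\le\frac CN\qquad\text{and}\qquad\mathbb E\big[{\rm COST}(\widehat\varphi^{\rm rMI})\big]\le CN .$$ -/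

import Mathlib

open MeasureTheory ProbabilityTheory Filter Topology

namespace RMISMC

noncomputable section

/-! ### Multi-indices, mixed differences and the coupled space -/

/-- Multi-indices `α = (α_1, …, α_D)` of nonnegative integers. -/
abbrev MultiIndex (D : ℕ) : Type := Fin D → ℕ

/-- The coupled space `X^(2^D)`. Its coordinates are labelled by the sets `S` of directions in which
a multi-index is lowered by one when a mixed difference is expanded into its `2^D` terms. -/
abbrev Coupled (D : ℕ) (X : Type*) : Type _ := Finset (Fin D) → X

/-- First-order difference in direction `i`:
`v α - v (α - e_i)` if `α_i > 0`, and `v α` if `α_i = 0`. -/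
def diff {D : ℕ} (i : Fin D) (v : MultiIndex D → ℝ) : MultiIndex D → ℝ :=
  fun α => if 0 < α i then v α - v (Function.update α i (α i - 1)) else v α

/-- First-order mixed difference `Δ = Δ_D ∘ ⋯ ∘ Δ_1`. -/
def mixedDiff {D : ℕ} (v : MultiIndex D → ℝ) : MultiIndex D → ℝ :=
  (List.finRange D).foldl (fun w i => diff i w) v

/-- The multi-index `α - ∑_{i ∈ S} e_i`, to be used only when `Admissible α S`. -/
def corner {D : ℕ} (α : MultiIndex D) (S : Finset (Fin D)) : MultiIndex D :=
  fun i => if i ∈ S then α i - 1 else α i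

/-- The term `S` is present in the mixed difference at `α`: no entry becomes negative. -/
def Admissible {D : ℕ} (α : MultiIndex D) (S : Finset (Fin D)) : Prop :=
  ∀ i ∈ S, 0 < α i

instance {D : ℕ} (α : MultiIndex D) (S : Finset (Fin D)) : Decidable (Admissible α S) := by
  unfold Admissible; infer_instance

/-- The mixed difference expanded: the term of `S` carries the sign `(-1)^|S|`. -/
theorem mixedDiff_eq_sum {D : ℕ} (v : MultiIndex D → ℝ) (α : MultiIndex D) :
    mixedDiff v α = ∑ S : Finset (Fin D),
      if Admissible α S then (-1 : ℝ) ^ S.card * v (corner α S) else 0 := by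
  have key : ∀ (l : List (Fin D)), l.Nodup → ∀ α : MultiIndex D,
      (l.foldl (fun w i => diff i w) v) α = ∑ S ∈ l.toFinset.powerset,
        if Admissible α S then (-1 : ℝ) ^ S.card * v (corner α S) else 0 := by
    intro l
    induction l using List.reverseRecOn with
    | nil =>
      intro _ α
      have h : corner α ∅ = α := by funext i; simp [corner]
      simp [Admissible, h]
    | append_singleton l i ih =>
      intro hl α
      have hnd : l.Nodup := (List.nodup_append.1 hl).1
      have hi : i ∉ l.toFinset := by
        rw [List.nodup_append] at hl
        intro h
        exact hl.2.2 i (List.mem_toFinset.1 h) i (by simp) rfl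
      have hins : (l ++ [i]).toFinset = insert i l.toFinset := by
        ext j; simp
      rw [List.foldl_append, hins, Finset.sum_powerset_insert hi]
      simp only [List.foldl_cons, List.foldl_nil, diff]
      split_ifs with hα
      · rw [ih hnd, ih hnd, sub_eq_add_neg, ← Finset.sum_neg_distrib]
        congr 1
        refine Finset.sum_congr rfl fun S hS => ?_
        have hiS : i ∉ S := fun h => hi (Finset.mem_powerset.1 hS h)
        have hA : Admissible (Function.update α i (α i - 1)) S ↔ Admissible α (insert i S) := by
          simp only [Admissible, Finset.mem_insert, forall_eq_or_imp, hα, true_and]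
          refine forall₂_congr fun j hj => ?_
          rw [Function.update_of_ne (by rintro rfl; exact hiS hj)]
        have hC : corner (Function.update α i (α i - 1)) S = corner α (insert i S) := by
          funext j
          by_cases hj : j = i
          · subst hj; simp [corner, hiS]
          · simp [corner, hj]
        simp only [hA, hC, Finset.card_insert_of_notMem hiS]
        split_ifs <;> ring
      · rw [ih hnd, left_eq_add]
        refine Finset.sum_eq_zero fun S _ => if_neg fun h => hα (h i (Finset.mem_insert_self _ _))
  have h := key (List.finRange D) (List.nodup_finRange D) α
  rw [mixedDiff, h]
  refine Finset.sum_congr ?_ fun _ _ => rfl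
  ext S; simp

/-! ### Coupled prior, coupled likelihood and the integrand of an increment -/

variable {D : ℕ} {X : Type*} [MeasurableSpace X]

/-- The coupled prior `Π₀`: the first coordinate has law `π₀`, all the others are equal to it. -/
def coupledPrior (D : ℕ) (prior : Measure X) : Measure (Coupled D X) :=
  prior.map (fun x _ => x)

/-- The likelihood entering the `S`-th coordinate of the coupling at `α` (zero when the
corresponding term of the mixed difference is absent). -/
def cornerLik (Lα : MultiIndex D → X → ℝ) (α : MultiIndex D) (S : Finset (Fin D)) (y : X) : ℝ :=
  if Admissible α S then Lα (corner α S) y else 0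

/-- The coupled likelihood: the maximum over the `2^D` coordinates. -/
def coupledLik (Lα : MultiIndex D → X → ℝ) (α : MultiIndex D) (x : Coupled D X) : ℝ :=
  Finset.univ.sup' Finset.univ_nonempty (fun S => cornerLik Lα α S (x S))

/-- `ψ_ζ(x) = ∑_S ι_S ω_S(x) ζ_{α - 1_S}(x_S)`, `ω_S(x) = L_{α - 1_S}(x_S) / max_{S'} L_{α - 1_{S'}}(x_{S'})`,
`ι_S = (-1)^|S|`. -/
def psi (Lα ζ : MultiIndex D → X → ℝ) (α : MultiIndex D) (x : Coupled D X) : ℝ :=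
  ∑ S : Finset (Fin D),
    (-1 : ℝ) ^ S.card * (cornerLik Lα α S (x S) / coupledLik Lα α x) * ζ (corner α S) (x S)

/-! ### The SMC sampler as a Markov chain on (normalising constant, particles) -/

section SMC

variable {E F : Type*} [MeasurableSpace E] [MeasurableSpace F] {n : ℕ}

/-- Conditionally independent draws: `b_i ∼ κ_i(a, ·)`, `i = 1, …, n`, given `a`. -/
def independentDraws (κ : Fin n → Kernel E F) (hκ : ∀ i, IsMarkovKernel (κ i)) :
    Kernel E (Fin n → F) where
  toFun a := Measure.pi (fun i => κ i a)
  measurable' := by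
    refine Measurable.measure_of_isPiSystem_of_isProbabilityMeasure
      (S := Set.pi Set.univ '' Set.pi Set.univ fun _ : Fin n => {s : Set F | MeasurableSet s})
      generateFrom_pi.symm isPiSystem_pi ?_
    rintro _ ⟨s, hs, rfl⟩
    simp only [Measure.pi_pi]
    exact Finset.measurable_prod _ fun i _ => (κ i).measurable_coe (hs i (Set.mem_univ i))

instance (κ : Fin n → Kernel E F) (hκ : ∀ i, IsMarkovKernel (κ i)) :
    IsMarkovKernel (independentDraws κ hκ) :=
  ⟨fun a => by
    change IsProbabilityMeasure (Measure.pi fun i => κ i a)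
    infer_instance⟩

/-- One draw from the weighted particles: `x_k` is selected with probability
`w_k = H(x_k) / ∑_l H(x_l)`. -/
def select (H : E → ℝ) (hH : Measurable H) : Kernel (Fin n → E) E where
  toFun x := ∑ k, ENNReal.ofReal (H (x k) / ∑ l, H (x l)) • Measure.dirac (x k)
  measurable' := by
    refine Measure.measurable_of_measurable_coe _ fun s hs => ?_
    simp only [Measure.coe_finsetSum, Finset.sum_apply, Measure.smul_apply, smul_eq_mul]
    refine Finset.measurable_sum _ fun k _ => Measurable.mul (by fun_prop) ?_
    exact (Measure.measurable_coe hs).comp (Measure.measurable_dirac.comp (measurable_pi_apply k))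

theorem isMarkovKernel_select (H : E → ℝ) (hH : Measurable H) (hpos : ∀ x, 0 < H x) (i : Fin n) :
    IsMarkovKernel (select (n := n) H hH) := by
  refine ⟨fun x => ⟨?_⟩⟩
  have hne : (Finset.univ : Finset (Fin n)).Nonempty := ⟨i, Finset.mem_univ i⟩
  have hs : 0 < ∑ l, H (x l) := Finset.sum_pos (fun l _ => hpos _) hne
  change (∑ k, ENNReal.ofReal (H (x k) / ∑ l, H (x l)) • Measure.dirac (x k)) Set.univ = 1
  simp only [Measure.coe_finsetSum, Finset.sum_apply, Measure.smul_apply, measure_univ,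
    smul_eq_mul, mul_one]
  rw [← ENNReal.ofReal_sum_of_nonneg fun k _ => (div_pos (hpos _) hs).le, ← Finset.sum_div,
    div_self hs.ne', ENNReal.ofReal_one]

/-- Multinomial resampling of the `n` particles with weights proportional to `H`. -/
def resample (H : E → ℝ) (hH : Measurable H) (hpos : ∀ x, 0 < H x) :
    Kernel (Fin n → E) (Fin n → E) :=
  independentDraws (fun _ => select H hH) (isMarkovKernel_select H hH hpos)

/-- Independent mutation of the `n` particles by the Markov kernel `M`. -/
def mutate (M : Kernel E E) [IsMarkovKernel M] : Kernel (Fin n → E) (Fin n → E) :=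
  independentDraws (fun i => M.comap (fun x => x i) (measurable_pi_apply i))
    (fun _ => inferInstance)

/-- One step of the sampler: the normalising constant is multiplied by the empirical mean of `H`,
and the particles are resampled and then mutated. -/
def smcStep (H : E → ℝ) (hH : Measurable H) (hpos : ∀ x, 0 < H x) (M : Kernel E E)
    [IsMarkovKernel M] : Kernel (ℝ × (Fin n → E)) (ℝ × (Fin n → E)) :=
  Kernel.deterministic (fun s => s.1 * ((∑ i, H (s.2 i)) / n)) (by fun_prop) ×ₖ
    (mutate M ∘ₖ resample H hH hpos).comap Prod.snd measurable_snd

instance (H : E → ℝ) (hH : Measurable H) (hpos : ∀ x, 0 < H x) (M : Kernel E E)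
    [IsMarkovKernel M] : IsMarkovKernel (smcStep (n := n) H hH hpos M) := by
  unfold smcStep mutate resample; infer_instance

/-- The estimate `F^n(ψ) = Z^n · (1/n) ∑ ψ(x_i)` read off the final state of a run. -/
def smcEstimate (ψ : E → ℝ) (s : ℝ × (Fin n → E)) : ℝ :=
  s.1 * ((∑ i, ψ (s.2 i)) / n)

end SMC

/-! ### The inference problem and its discretisations -/

/-- A Bayesian inference problem with prior `π₀` and likelihood `L`, approximate likelihoods `L_α`,
and for each `α` a sequence of intermediate distributions `F_{α,0}, …, F_{α,J} = F_α` on the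
coupled space, `F_{α,j} = dens α j · Π₀`, with Markov kernels leaving them invariant.
Only the stages `j ≤ J` are used. The first distribution is normalised, since the sampler starts
from independent draws of it with normalising constant one. -/
structure Problem (D : ℕ) (X : Type*) [MeasurableSpace X] where
  /-- the prior `π₀` -/
  prior : Measure X
  prior_prob : IsProbabilityMeasure prior
  /-- the likelihood `L` -/
  L : X → ℝ
  L_nonneg : ∀ x, 0 ≤ L x
  L_integrable : Integrable L prior
  /-- the approximate likelihoods `L_α` -/
  Lα : MultiIndex D → X → ℝ
  Lα_nonneg : ∀ α x, 0 ≤ Lα α x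
  Lα_measurable : ∀ α, Measurable (Lα α)
  /-- the number of SMC steps -/
  J : ℕ
  /-- the density of `F_{α,j}` with respect to the coupled prior -/
  dens : MultiIndex D → ℕ → Coupled D X → ℝ
  dens_pos : ∀ α j x, 0 < dens α j x
  dens_measurable : ∀ α j, Measurable (dens α j)
  dens_last : ∀ α x, dens α J x = coupledLik Lα α x
  dens_first : ∀ α, ∫⁻ x, ENNReal.ofReal (dens α 0 x) ∂(coupledPrior D prior) = 1
  /-- the kernel used to mutate the particles on entering stage `j ≥ 1` -/
  M : MultiIndex D → ℕ → Kernel (Coupled D X) (Coupled D X)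
  M_markov : ∀ α j, IsMarkovKernel (M α j)
  M_invariant : ∀ α j, 1 ≤ j → j ≤ J →
    Kernel.Invariant (M α j)
      ((coupledPrior D prior).withDensity fun x => ENNReal.ofReal (dens α j x))

namespace Problem

variable (P : Problem D X)

instance : IsProbabilityMeasure P.prior := P.prior_prob

instance (α : MultiIndex D) (j : ℕ) : IsMarkovKernel (P.M α j) := P.M_markov α j

/-- The unnormalised target `f(ζ) = ∫ ζ L dπ₀`. -/
def f (ζ : X → ℝ) : ℝ := ∫ x, ζ x * P.L x ∂P.prior

/-- The unnormalised approximate target `f_α(ζ) = ∫ ζ L_α dπ₀`. -/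
def fα (α : MultiIndex D) (ζ : X → ℝ) : ℝ := ∫ x, ζ x * P.Lα α x ∂P.prior

/-- The normalising constant `Z = f(1)`. -/
def Z : ℝ := P.f 1

/-- The posterior expectation `π(φ) = f(φ) / f(1)`. -/
def posterior (φ : X → ℝ) : ℝ := P.f φ / P.f 1

/-- The intermediate measure `F_{α,j}` on the coupled space. -/
def interm (α : MultiIndex D) (j : ℕ) : Measure (Coupled D X) :=
  (coupledPrior D P.prior).withDensity fun x => ENNReal.ofReal (P.dens α j x)

instance (α : MultiIndex D) : IsProbabilityMeasure (P.interm α 0) :=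
  ⟨by rw [interm, withDensity_apply _ MeasurableSet.univ, Measure.restrict_univ, P.dens_first]⟩

/-- The potential `H_{α,j} = F_{α,j+1} / F_{α,j}`. -/
def H (α : MultiIndex D) (j : ℕ) (x : Coupled D X) : ℝ := P.dens α (j + 1) x / P.dens α j x

theorem H_pos (α : MultiIndex D) (j : ℕ) (x : Coupled D X) : 0 < P.H α j x :=
  div_pos (P.dens_pos _ _ _) (P.dens_pos _ _ _)

theorem H_measurable (α : MultiIndex D) (j : ℕ) : Measurable (P.H α j) :=
  (P.dens_measurable α (j + 1)).div (P.dens_measurable α j)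

/-- Law of the state of the sampler with `n` particles at stage `j`. -/
def smcLawAt (α : MultiIndex D) (n : ℕ) : ℕ → Measure (ℝ × (Fin n → Coupled D X))
  | 0 => (Measure.dirac 1).prod (Measure.pi fun _ => P.interm α 0)
  | j + 1 => (smcLawAt α n j).bind
      (smcStep (P.H α j) (P.H_measurable α j) (P.H_pos α j) (P.M α (j + 1)))

instance (α : MultiIndex D) (n j : ℕ) : IsProbabilityMeasure (P.smcLawAt α n j) := by
  induction j with
  | zero => unfold smcLawAt; infer_instance
  | succ j ih => unfold smcLawAt; infer_instance

/-- Law of the final state of a complete run of the SMC sampler at `α` with `n` particles. -/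
def smcLaw (α : MultiIndex D) (n : ℕ) : Measure (ℝ × (Fin n → Coupled D X)) :=
  P.smcLawAt α n P.J

instance (α : MultiIndex D) (n : ℕ) : IsProbabilityMeasure (P.smcLaw α n) := by
  unfold smcLaw; infer_instance

/-! ### Assumptions -/

/-- Two-sided bounds, uniform in `α`, on the normalising constant, on the density of the initial
distribution with respect to the coupled prior, and on the potentials of all steps. -/
def BoundedPotentials : Prop :=
  ∃ C : ℝ, 0 < C ∧ C⁻¹ < P.Z ∧ P.Z ≤ C ∧
    (∀ α x, C⁻¹ < P.dens α 0 x ∧ P.dens α 0 x ≤ C) ∧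
    ∀ α x, ∀ j < P.J, C⁻¹ < P.H α j x ∧ P.H α j x ≤ C

/-- Variance rate: `∫ (Δ (L_α ζ_α))² dπ₀ ≤ C ∏ 2^(-α_i β_i)`. -/
def VarianceRate (ζ : MultiIndex D → X → ℝ) (β : Fin D → ℝ) : Prop :=
  ∃ C : ℝ, 0 < C ∧ ∀ α : MultiIndex D,
    Integrable (fun x => mixedDiff (fun a => P.Lα a x * ζ a x) α ^ 2) P.prior ∧
    ∫ x, mixedDiff (fun a => P.Lα a x * ζ a x) α ^ 2 ∂P.prior ≤
      C * ∏ i, (2 : ℝ) ^ (-(α i : ℝ) * β i)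

/-! ### The randomized estimator -/

/-- Sample space for `m` draws of a multi-index and, for every `α` and every number `n` of
particles, one run of the sampler at `α` with `n` particles. The estimator uses, for each drawn `α`,
only the run whose number of particles is the random `N_α`. -/
abbrev Sample (D : ℕ) (X : Type*) (m : ℕ) : Type _ :=
  (Fin m → MultiIndex D) × ((q : MultiIndex D × ℕ) → ℝ × (Fin q.2 → Coupled D X))

/-- The draws are i.i.d. with law `p`; all runs are independent of the draws and of each other. -/
def sampleLaw (p : PMF (MultiIndex D)) (m : ℕ) : Measure (Sample D X m) :=
  (Measure.pi fun _ : Fin m => p.toMeasure).prod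
    (Measure.infinitePi fun q : MultiIndex D × ℕ => P.smcLaw q.1 q.2)

instance (p : PMF (MultiIndex D)) (m : ℕ) : IsProbabilityMeasure (P.sampleLaw p m) := by
  unfold sampleLaw; infer_instance

/-- The number of particles `N_α = N_min #{i : α_i = α}` allocated to `α`. -/
def count (Nmin : ℕ) {m : ℕ} (A : Fin m → MultiIndex D) (α : MultiIndex D) : ℕ :=
  Nmin * (Finset.univ.filter fun i => A i = α).card

/-- `F̂(ζ) = ∑_α N_α / (N p_α) F_α^{N_α}(ψ_ζ)` with `N = m N_min`; at most `m` terms are nonzero. -/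
def Fhat (p : PMF (MultiIndex D)) (Nmin m : ℕ) (ζ : MultiIndex D → X → ℝ) (ω : Sample D X m) : ℝ :=
  ∑' α : MultiIndex D, (count Nmin ω.1 α : ℝ) / (((m * Nmin : ℕ) : ℝ) * (p α).toReal) *
    smcEstimate (psi P.Lα ζ α) (ω.2 (α, count Nmin ω.1 α))

/-- The ratio estimator `F̂(φ) / max{F̂(1), Z_min}`. -/
def ratioEstimator (p : PMF (MultiIndex D)) (Nmin m : ℕ) (Zmin : ℝ) (φα : MultiIndex D → X → ℝ)
    (ω : Sample D X m) : ℝ :=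
  P.Fhat p Nmin m φα ω / max (P.Fhat p Nmin m (fun _ _ => 1) ω) Zmin

end Problem

/-- Cost of a realisation, `∑_α N_α C_α`, where `C_α` is the cost of one particle at `α`; at most
`m` terms are nonzero. -/
def totalCost (cost : MultiIndex D → ℝ) (Nmin : ℕ) {m : ℕ} (A : Fin m → MultiIndex D) : ℝ :=
  ∑' α : MultiIndex D, (Problem.count Nmin A α : ℝ) * cost α

end

end RMISMC

/-! The estimator is importance sampling over multi-indices with an independent noisy evaluation of
each drawn increment. Write `g_α = ∫ Δ(L_α ζ_α) dπ₀`. Everything rests on three facts, with `V_α` of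
order `∏ 2^(-α_i β_i)`: a run with `n` particles has mean `g_α`, its variance is at most `V_α / n`,
and `g_α² ≤ V_α`.

For one run, the induction over stages (`IsParticleApprox.step`) carries unbiasedness together with
the bound `E[F^n(g)²] ≤ F(g)² + (K/n) F(g²)`. The leading constant is exactly one, so unbiasedness
cancels it and leaves a variance bound of order `1/n`, with `K` depending only on the bounds on the
densities. Since `Π₀` lives on the diagonal, where density times `ψ` is the mixed difference
(`dens_mul_psi_diagonal`), the lower bound on the final density turns `F_α(ψ²)` into a multiple of
`∫ (Δ(L_α ζ_α))² dπ₀`.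

Given the draws, the runs used are independent, and the conditional mean is an empirical mean of
`g/p`, whose expectation is `∑ g_α`. Run noise and draw noise each contribute at most `(1/m) ∑ V_α /
p_α`. For the chosen `p`, both `V_α / p_α` and `p_α C_α` are bounded by multiples of `∏ 2^(-α_i (β_i
- γ_i)/2)`, which is summable because `β_i > γ_i`. The increments telescope over boxes
(`sum_Iic_mixedDiff`) and are absolutely summable, so convergence without rate already identifies `∑
g_α` with the exact integral. Finally `sq_ratio_sub_ratio_le` passes from numerator and denominator
to the truncated ratio. -/

namespace RMISMC

/-! ### Second moments, empirical means and products of kernels. -/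

section Moments

variable {Ω E : Type*} [MeasurableSpace Ω] [MeasurableSpace E]

theorem memLp_two_of_lintegral_sq_ne_top {μ : Measure Ω} {g : Ω → ℝ}
    (hg : AEStronglyMeasurable g μ) (h : ∫⁻ x, ENNReal.ofReal (g x ^ 2) ∂μ ≠ ⊤) :
    MemLp g 2 μ := by
  rw [memLp_two_iff_integrable_sq hg]
  refine ⟨hg.pow 2, ?_⟩
  rw [hasFiniteIntegral_iff_ofReal (ae_of_all _ fun x => sq_nonneg _)]
  exact h.lt_top

/-- Decomposition of the mean square error into variance and squared bias. -/
theorem lintegral_sq_sub_eq {μ : Measure Ω} [IsProbabilityMeasure μ] {Y : Ω → ℝ}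
    (hY : MemLp Y 2 μ) (a : ℝ) :
    ∫⁻ x, ENNReal.ofReal ((Y x - a) ^ 2) ∂μ
      = ENNReal.ofReal (Var[Y; μ]) + ENNReal.ofReal ((∫ x, Y x ∂μ - a) ^ 2) := by
  have hYa : MemLp (fun x => Y x - a) 2 μ := hY.sub (memLp_const a)
  have h1 := variance_eq_sub hYa
  have h2 := variance_sub_const hY.1 a
  have h3 : ∫ x, (Y x - a) ∂μ = ∫ x, Y x ∂μ - a := by
    rw [integral_sub (hY.integrable (by norm_num)) (integrable_const a)]; simp
  rw [← ENNReal.ofReal_add (variance_nonneg _ _) (sq_nonneg _),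
    ← ofReal_integral_eq_lintegral_ofReal hYa.integrable_sq (ae_of_all _ fun x => sq_nonneg _)]
  congr 1
  rw [← h2, h1, h3]
  simp

/-- The variance is nonnegative. With values in `ENNReal` no integrability is required: an infinite
second moment makes the bound trivial. -/
theorem ofReal_sq_integral_le (μ : Measure Ω) [IsProbabilityMeasure μ] {g : Ω → ℝ}
    (hg : AEStronglyMeasurable g μ) :
    ENNReal.ofReal ((∫ x, g x ∂μ) ^ 2) ≤ ∫⁻ x, ENNReal.ofReal (g x ^ 2) ∂μ := by
  by_cases h : ∫⁻ x, ENNReal.ofReal (g x ^ 2) ∂μ = ⊤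
  · simp [h]
  · have := lintegral_sq_sub_eq (memLp_two_of_lintegral_sq_ne_top hg h) 0
    simp only [sub_zero] at this
    rw [this]
    exact le_add_self

theorem ofReal_variance_le_lintegral_sq (μ : Measure Ω) [IsProbabilityMeasure μ] {g : Ω → ℝ}
    (hg : MemLp g 2 μ) :
    ENNReal.ofReal (Var[g; μ]) ≤ ∫⁻ x, ENNReal.ofReal (g x ^ 2) ∂μ := by
  have := lintegral_sq_sub_eq hg 0
  simp only [sub_zero] at this
  rw [this]
  exact le_self_add

/-- Mean square error of the empirical mean of i.i.d. draws as an estimate of `a`. -/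
theorem lintegral_sq_empiricalMean_sub_le {n : ℕ} (hn : 0 < n) (ν : Measure E)
    [IsProbabilityMeasure ν] {g : E → ℝ} (hg : Measurable g) (a : ℝ) :
    ∫⁻ y : Fin n → E, ENNReal.ofReal (((∑ i, g (y i)) / n - a) ^ 2) ∂(Measure.pi fun _ => ν)
      ≤ ENNReal.ofReal ((∫ x, g x ∂ν - a) ^ 2)
        + (n : ENNReal)⁻¹ * ∫⁻ x, ENNReal.ofReal (g x ^ 2) ∂ν := by
  by_cases h : ∫⁻ x, ENNReal.ofReal (g x ^ 2) ∂ν = ⊤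
  · rw [h, ENNReal.mul_top (by simp)]; simp
  have hm := memLp_two_of_lintegral_sq_ne_top hg.aestronglyMeasurable h
  have hn' : (n : ℝ) ≠ 0 := by positivity
  have hmi : ∀ i, MemLp (fun y : Fin n → E => g (y i)) 2 (Measure.pi fun _ => ν) := fun i =>
    hm.comp_measurePreserving (measurePreserving_eval (fun _ : Fin n => ν) i)
  have hsum : MemLp (fun y : Fin n → E => ∑ i, g (y i)) 2 (Measure.pi fun _ => ν) :=
    memLp_finsetSum _ fun i _ => hmi i
  have hY : MemLp (fun y : Fin n → E => (∑ i, g (y i)) / n) 2 (Measure.pi fun _ => ν) := by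
    simpa only [div_eq_mul_inv] using hsum.mul_const _
  rw [lintegral_sq_sub_eq hY, add_comm]
  have hmean : ∫ y : Fin n → E, (∑ i, g (y i)) / n ∂(Measure.pi fun _ => ν) = ∫ x, g x ∂ν := by
    rw [integral_div, integral_finsetSum _ fun i _ => (hmi i).integrable (by norm_num)]
    have : ∀ i : Fin n, ∫ y : Fin n → E, g (y i) ∂(Measure.pi fun _ => ν) = ∫ x, g x ∂ν :=
      fun i => integral_comp_eval (μ := fun _ : Fin n => ν) hg.aestronglyMeasurable
    simp only [this, Finset.sum_const, Finset.card_univ, Fintype.card_fin, nsmul_eq_mul]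
    field_simp
  have hvar : Var[fun y : Fin n → E => (∑ i, g (y i)) / n; Measure.pi fun _ => ν]
      = (n : ℝ)⁻¹ * Var[g; ν] := by
    simp only [div_eq_inv_mul]
    rw [variance_const_mul]
    have := variance_sum_pi (μ := fun _ : Fin n => ν) (X := fun _ => g) (fun _ => hm)
    have e : (∑ i : Fin n, fun ω : Fin n → E => g (ω i)) = fun y => ∑ i, g (y i) := by
      ext y; simp
    rw [e] at this
    rw [this]
    simp only [Finset.sum_const, Finset.card_univ, Fintype.card_fin, nsmul_eq_mul]
    field_simp
  rw [hmean, hvar, ENNReal.ofReal_mul (by positivity), ENNReal.ofReal_inv_of_pos (by positivity),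
    ENNReal.ofReal_natCast]
  gcongr
  exact ofReal_variance_le_lintegral_sq ν hm

/-- Independent draws followed by independent moves are independent. -/
theorem pi_bind_independentDraws {n : ℕ} {F : Type*} [MeasurableSpace F] (μ : Fin n → Measure E)
    [∀ i, IsProbabilityMeasure (μ i)] (M : Kernel E F) [IsMarkovKernel M]
    (hκ : ∀ i : Fin n, IsMarkovKernel (M.comap (fun x : Fin n → E => x i) (measurable_pi_apply i))) :
    (Measure.pi μ).bind
        (independentDraws (fun i => M.comap (fun x : Fin n → E => x i) (measurable_pi_apply i)) hκ)
      = Measure.pi fun i => (μ i).bind M := by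
  refine (Measure.pi_eq fun s hs => ?_).symm
  rw [Measure.bind_apply (MeasurableSet.univ_pi hs) (Kernel.aemeasurable _)]
  have h1 : ∀ x : Fin n → E,
      independentDraws (fun i => M.comap (fun x : Fin n → E => x i) (measurable_pi_apply i)) hκ x
        (Set.univ.pi s) = ∏ i, M (x i) (s i) := fun x => Measure.pi_pi _ _
  simp only [h1]
  have hm : ∀ i, Measurable fun x => M x (s i) := fun i => M.measurable_coe (hs i)
  have hind := iIndepFun_pi (μ := μ) (X := fun i x => M x (s i)) fun i => (hm i).aemeasurable
  rw [lintegral_prod_eq_prod_lintegral_of_indepFun Finset.univ _ hind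
    fun i => (hm i).comp (measurable_pi_apply i)]
  refine Finset.prod_congr rfl fun i _ => ?_
  rw [Measure.bind_apply (hs i) (Kernel.aemeasurable _)]
  exact (measurePreserving_eval μ i).lintegral_comp (hm i)

end Moments

/-! ### Unbiasedness and second moments of the particle system, one stage at a time. -/

section Sampler

variable {E : Type*} [MeasurableSpace E] {n : ℕ}

theorem measurable_smcEstimate {g : E → ℝ} (hg : Measurable g) :
    Measurable (smcEstimate (n := n) g) := by
  unfold smcEstimate; fun_prop

theorem select_bind (H : E → ℝ) (hH : Measurable H) (M : Kernel E E) (x : Fin n → E) :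
    (select H hH x).bind M = ∑ k, ENNReal.ofReal (H (x k) / ∑ l, H (x l)) • M (x k) := by
  have e : select H hH x
      = ∑ k, ENNReal.ofReal (H (x k) / ∑ l, H (x l)) • Measure.dirac (x k) := rfl
  ext s hs
  rw [Measure.bind_apply hs (Kernel.aemeasurable _), e, lintegral_finsetSum_measure]
  simp only [lintegral_smul_measure, smul_eq_mul, Measure.coe_finsetSum, Finset.sum_apply,
    Measure.smul_apply]
  refine Finset.sum_congr rfl fun k _ => ?_
  rw [lintegral_dirac' _ (M.measurable_coe hs)]

/-- Integration against one step of the sampler: new particles are i.i.d. given the old state. -/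
theorem lintegral_smcStep (H : E → ℝ) (hH : Measurable H) (hpos : ∀ x, 0 < H x) (M : Kernel E E)
    [IsMarkovKernel M] (hn : 0 < n) {G : ℝ × (Fin n → E) → ENNReal} (hG : Measurable G)
    (s : ℝ × (Fin n → E)) :
    ∫⁻ t, G t ∂(smcStep H hH hpos M s)
      = ∫⁻ y, G (s.1 * ((∑ i, H (s.2 i)) / n), y)
          ∂(Measure.pi fun _ : Fin n => (select H hH s.2).bind M) := by
  have : IsMarkovKernel (mutate (n := n) M) := by unfold mutate; infer_instance
  have : IsMarkovKernel (resample (n := n) H hH hpos) := by unfold resample; infer_instance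
  have : IsProbabilityMeasure (select H hH s.2) :=
    (isMarkovKernel_select H hH hpos ⟨0, hn⟩).isProbabilityMeasure _
  have e : (mutate (n := n) M ∘ₖ resample H hH hpos) s.2
      = Measure.pi fun _ : Fin n => (select H hH s.2).bind M := by
    rw [Kernel.comp_apply]
    exact pi_bind_independentDraws (fun _ : Fin n => select H hH s.2) M _
  rw [smcStep, Kernel.lintegral_deterministic_prod _ _ _ hG, Kernel.comap_apply, e]

/-- The law of a state `(Z, particles)` of the sampler approximates the measure `F`: the
normalising constant lies in `[0, B]`, the estimates of nonnegative functions are unbiased, and the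
estimate of `g` has a second moment of at most `F(g)² + (K / n) F(g²)`. -/
structure IsParticleApprox (law : Measure (ℝ × (Fin n → E))) (F : Measure E) (B : ℝ)
    (K : ENNReal) : Prop where
  bounded : ∀ᵐ s ∂law, 0 ≤ s.1 ∧ s.1 ≤ B
  unbiased : ∀ u : E → ENNReal, Measurable u →
    ∫⁻ s, ENNReal.ofReal s.1 * ((∑ i, u (s.2 i)) / n) ∂law = ∫⁻ x, u x ∂F
  second_moment : ∀ g : E → ℝ, Measurable g →
    ∫⁻ s, ENNReal.ofReal (smcEstimate g s ^ 2) ∂law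
      ≤ ENNReal.ofReal ((∫ x, g x ∂F) ^ 2)
        + K * (n : ENNReal)⁻¹ * ∫⁻ x, ENNReal.ofReal (g x ^ 2) ∂F

theorem isParticleApprox_init (hn : 0 < n) (F : Measure E) [IsProbabilityMeasure F] :
    IsParticleApprox ((Measure.dirac (1 : ℝ)).prod (Measure.pi fun _ : Fin n => F)) F 1 1 := by
  have hn' : (n : ENNReal) ≠ 0 := by simpa using hn.ne'
  have key : ∀ G : ℝ × (Fin n → E) → ENNReal, Measurable G →
      ∫⁻ s, G s ∂((Measure.dirac (1 : ℝ)).prod (Measure.pi fun _ : Fin n => F))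
        = ∫⁻ y, G (1, y) ∂(Measure.pi fun _ : Fin n => F) := fun G hG => by
    rw [lintegral_prod _ hG.aemeasurable, lintegral_dirac' _ hG.lintegral_prod_right']
  refine ⟨?_, fun u hu => ?_, fun g hg => ?_⟩
  · have hS : MeasurableSet {s : ℝ × (Fin n → E) | 0 ≤ s.1 ∧ s.1 ≤ 1} :=
      (measurableSet_Icc (a := (0 : ℝ)) (b := 1)).preimage measurable_fst
    refine mem_ae_iff.2 ?_
    rw [← lintegral_indicator_one hS.compl, key _ (measurable_one.indicator hS.compl)]
    simp
  · rw [key _ (by fun_prop)]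
    simp only [ENNReal.ofReal_one, one_mul, div_eq_mul_inv]
    rw [lintegral_mul_const _ (by fun_prop), lintegral_finsetSum _ fun i _ => by fun_prop]
    have : ∀ i : Fin n, ∫⁻ y : Fin n → E, u (y i) ∂(Measure.pi fun _ => F) = ∫⁻ x, u x ∂F :=
      fun i => (measurePreserving_eval (fun _ : Fin n => F) i).lintegral_comp hu
    simp only [this, Finset.sum_const, Finset.card_univ, Fintype.card_fin, nsmul_eq_mul]
    rw [mul_right_comm, ENNReal.mul_inv_cancel hn' (by simp), one_mul]
  · have := measurable_smcEstimate (n := n) hg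
    rw [key _ (by fun_prop)]
    have h := lintegral_sq_empiricalMean_sub_le hn F hg 0
    simpa only [smcEstimate, one_mul, sub_zero] using h

/-- The factor multiplying the normalising constant is, up to `n`, the denominator of the resampling
weights. Their product is therefore linear in the old particles, which lets unbiasedness pass from
one stage to the next. -/
theorem ofReal_mean_mul_lintegral_select_bind
    {H : E → ℝ} (hH : Measurable H) (hpos : ∀ x, 0 < H x) (M : Kernel E E)
    (hn : 0 < n) (u : E → ENNReal)
    (s : ℝ × (Fin n → E)) :
    ENNReal.ofReal (s.1 * ((∑ i, H (s.2 i)) / n)) * ∫⁻ x, u x ∂((select H hH s.2).bind M)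
      = ENNReal.ofReal s.1
        * ((∑ i, ENNReal.ofReal (H (s.2 i)) * ∫⁻ y, u y ∂(M (s.2 i))) / n) := by
  have hne : (Finset.univ : Finset (Fin n)).Nonempty := ⟨⟨0, hn⟩, Finset.mem_univ _⟩
  have hs : 0 < ∑ l, H (s.2 l) := Finset.sum_pos (fun l _ => hpos _) hne
  have hn0 : (0 : ℝ) < n := by exact_mod_cast hn
  rw [select_bind, lintegral_finsetSum_measure, ENNReal.ofReal_mul' (by positivity), mul_assoc]
  congr 1
  simp only [lintegral_smul_measure, smul_eq_mul]
  rw [Finset.mul_sum, ENNReal.div_eq_inv_mul, Finset.mul_sum]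
  refine Finset.sum_congr rfl fun k _ => ?_
  rw [← mul_assoc, ← ENNReal.ofReal_mul (div_nonneg hs.le hn0.le), ← mul_assoc]
  congr 1
  rw [← ENNReal.ofReal_natCast, ← ENNReal.ofReal_inv_of_pos hn0,
    ← ENNReal.ofReal_mul (inv_nonneg.2 hn0.le)]
  congr 1
  field_simp

/-- Given the old state the new particles are i.i.d., so the conditional second moment is a squared
mean plus a variance of order `1/n`. By cancellation of the weight denominator, the conditional mean
is the old estimate of `H · Mg`. -/
theorem lintegral_sq_smcEstimate_le
    {H : E → ℝ} (hH : Measurable H) (hpos : ∀ x, 0 < H x) (M : Kernel E E)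
    [IsMarkovKernel M] (hn : 0 < n) {g : E → ℝ} (hg : Measurable g)
    (s : ℝ × (Fin n → E)) :
    ∫⁻ y : Fin n → E, ENNReal.ofReal (smcEstimate g (s.1 * ((∑ i, H (s.2 i)) / n), y) ^ 2)
        ∂(Measure.pi fun _ => (select H hH s.2).bind M)
      ≤ ENNReal.ofReal (smcEstimate (fun x => H x * ∫ y, g y ∂(M x)) s ^ 2)
        + ENNReal.ofReal ((s.1 * ((∑ i, H (s.2 i)) / n)) ^ 2)
          * ((n : ENNReal)⁻¹ * ∫⁻ x, ENNReal.ofReal (g x ^ 2) ∂((select H hH s.2).bind M)) := by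
  have hne : (Finset.univ : Finset (Fin n)).Nonempty := ⟨⟨0, hn⟩, Finset.mem_univ _⟩
  have hs : 0 < ∑ l, H (s.2 l) := Finset.sum_pos (fun l _ => hpos _) hne
  have hn0 : (0 : ℝ) < n := by exact_mod_cast hn
  have : IsProbabilityMeasure (select H hH s.2) :=
    (isMarkovKernel_select H hH hpos ⟨0, hn⟩).isProbabilityMeasure _
  set z := s.1 * ((∑ i, H (s.2 i)) / n) with hz
  set ν := (select H hH s.2).bind M with hν
  have hL : ∫⁻ y : Fin n → E, ENNReal.ofReal (smcEstimate g (z, y) ^ 2) ∂(Measure.pi fun _ => ν)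
      = ENNReal.ofReal (z ^ 2)
        * ∫⁻ y : Fin n → E, ENNReal.ofReal (((∑ i, g (y i)) / n) ^ 2) ∂(Measure.pi fun _ => ν) := by
    rw [← lintegral_const_mul _ (by fun_prop)]
    refine lintegral_congr fun y => ?_
    rw [smcEstimate, mul_pow, ENNReal.ofReal_mul (sq_nonneg _)]
  rw [hL]
  have hmain := lintegral_sq_empiricalMean_sub_le hn ν hg 0
  simp only [sub_zero] at hmain
  refine (mul_le_mul_right hmain _).trans ?_
  rw [mul_add]
  -- With an infinite second moment the right side is infinite if `z ≠ 0`; if `z = 0`, the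
  -- convention `0 · ∞ = 0` makes the left side vanish.
  by_cases h : ∫⁻ x, ENNReal.ofReal (g x ^ 2) ∂ν = ⊤
  · rw [h, ENNReal.mul_top (by simp)]
    by_cases hz0 : z = 0
    · simp [hz0]
    · rw [ENNReal.mul_top (by simpa using hz0)]; simp
  refine add_le_add_left (le_of_eq ?_) _
  rw [← ENNReal.ofReal_mul (sq_nonneg _), ← mul_pow]
  congr 2
  rw [hν, select_bind] at h ⊢
  rw [lintegral_finsetSum_measure] at h
  -- All mixture weights are strictly positive, so a finite second moment under the mixture is
  -- finite under every component.
  have hint : ∀ k, Integrable g (M (s.2 k)) := fun k => by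
    refine (memLp_two_of_lintegral_sq_ne_top hg.aestronglyMeasurable fun htop => h ?_).integrable
      (by norm_num)
    refine ENNReal.sum_eq_top.2 ⟨k, Finset.mem_univ _, ?_⟩
    rw [lintegral_smul_measure, htop, smul_eq_mul, ENNReal.mul_top]
    simpa using div_pos (hpos _) hs
  rw [integral_finsetSum_measure fun k _ => (hint k).smul_measure ENNReal.ofReal_ne_top]
  simp only [integral_smul_measure, smul_eq_mul, smcEstimate, hz]
  rw [mul_assoc]
  congr 1
  rw [Finset.mul_sum, eq_div_iff hn0.ne', Finset.sum_mul]
  refine Finset.sum_congr rfl fun k _ => ?_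
  rw [ENNReal.toReal_ofReal (div_pos (hpos _) hs).le]
  field_simp

/-- The new constant collects two errors. The inherited one is `K F((H · Mg)²) ≤ K C F'(g²)`; the
fresh sampling error is at most `B C F'(g²)`, since the new normalising constant is at most `B C`.
-/
theorem IsParticleApprox.step
    {H : E → ℝ} (hH : Measurable H) (hpos : ∀ x, 0 < H x) (M : Kernel E E)
    [IsMarkovKernel M] (hn : 0 < n) {law : Measure (ℝ × (Fin n → E))} {F F' : Measure E}
    {B C : ℝ} {K : ENNReal} (hB : 0 ≤ B) (hHC : ∀ x, H x ≤ C) (h : IsParticleApprox law F B K)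
    (hF : F' = F.withDensity fun x => ENNReal.ofReal (H x)) (hM : Kernel.Invariant M F')
    [IsFiniteMeasure F'] (hK : K ≠ 0) :
    IsParticleApprox (law.bind (smcStep H hH hpos M)) F' (B * C)
      (K * ENNReal.ofReal C + ENNReal.ofReal (B * C)) := by
  have hn' : (n : ENNReal) ≠ 0 := by simpa using hn.ne'
  have hn0 : (0 : ℝ) < n := by exact_mod_cast hn
  have : ∀ x : Fin n → E, IsProbabilityMeasure (select H hH x) :=
    fun x => (isMarkovKernel_select H hH hpos ⟨0, hn⟩).isProbabilityMeasure _
  have key : ∀ G : ℝ × (Fin n → E) → ENNReal, Measurable G →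
      ∫⁻ t, G t ∂(law.bind (smcStep H hH hpos M))
        = ∫⁻ s, ∫⁻ y, G (s.1 * ((∑ i, H (s.2 i)) / n), y)
            ∂(Measure.pi fun _ : Fin n => (select H hH s.2).bind M) ∂law := fun G hG => by
    rw [Measure.lintegral_bind (Kernel.aemeasurable _) hG.aemeasurable]
    exact lintegral_congr fun s => lintegral_smcStep H hH hpos M hn hG s
  have hmean_le : ∀ x : Fin n → E, (∑ i, H (x i)) / n ≤ C := fun x => by
    rw [div_le_iff₀ hn0]
    refine (Finset.sum_le_card_nsmul _ _ C fun i _ => hHC _).trans ?_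
    simp [mul_comm]
  have hmean_pos : ∀ x : Fin n → E, 0 ≤ (∑ i, H (x i)) / n := fun x =>
    div_nonneg (Finset.sum_nonneg fun i _ => (hpos _).le) hn0.le
  -- `F'` has density `H` with respect to `F` and is invariant under `M`, so `u ↦ H · Mu` transports
  -- integrals from `F'` back to `F`.
  have hinv : ∀ u : E → ENNReal, Measurable u →
      ∫⁻ x, ENNReal.ofReal (H x) * ∫⁻ y, u y ∂(M x) ∂F = ∫⁻ x, u x ∂F' := fun u hu => by
    conv_rhs => rw [← hM.def, Measure.lintegral_bind (Kernel.aemeasurable _) hu.aemeasurable, hF,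
      lintegral_withDensity_eq_lintegral_mul _ (by fun_prop) hu.lintegral_kernel]
    rfl
  have hunb : ∀ u : E → ENNReal, Measurable u →
      ∫⁻ s, ENNReal.ofReal (s.1 * ((∑ i, H (s.2 i)) / n))
          * ∫⁻ x, u x ∂((select H hH s.2).bind M) ∂law = ∫⁻ x, u x ∂F' := fun u hu => by
    rw [← hinv u hu, ← h.unbiased (fun x => ENNReal.ofReal (H x) * ∫⁻ y, u y ∂(M x))
      (hH.ennreal_ofReal.mul hu.lintegral_kernel)]
    exact lintegral_congr fun s => ofReal_mean_mul_lintegral_select_bind hH hpos M hn u s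
  refine ⟨?_, fun u hu => ?_, fun g hg => ?_⟩
  · have hS : MeasurableSet {s : ℝ × (Fin n → E) | 0 ≤ s.1 ∧ s.1 ≤ B * C} :=
      (measurableSet_Icc (a := (0 : ℝ)) (b := B * C)).preimage measurable_fst
    refine mem_ae_iff.2 ?_
    rw [← lintegral_indicator_one hS.compl, key _ (measurable_one.indicator hS.compl)]
    rw [← lintegral_zero (μ := law)]
    refine lintegral_congr_ae ?_
    filter_upwards [h.bounded] with s hs
    have h1 : 0 ≤ s.1 * ((∑ i, H (s.2 i)) / n) := mul_nonneg hs.1 (hmean_pos _)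
    have h2 : s.1 * ((∑ i, H (s.2 i)) / n) ≤ B * C :=
      mul_le_mul hs.2 (hmean_le _) (hmean_pos _) hB
    simp [h1, h2]
  · rw [key _ (by fun_prop), ← hunb u hu]
    refine lintegral_congr fun s => ?_
    dsimp only
    rw [lintegral_const_mul _ (by fun_prop)]
    congr 1
    simp only [div_eq_mul_inv]
    rw [lintegral_mul_const _ (by fun_prop), lintegral_finsetSum _ fun i _ => by fun_prop]
    have : ∀ i : Fin n, ∫⁻ y : Fin n → E, u (y i)
        ∂(Measure.pi fun _ => (select H hH s.2).bind M) = ∫⁻ x, u x ∂((select H hH s.2).bind M) :=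
      fun i => (measurePreserving_eval
        (fun _ : Fin n => (select H hH s.2).bind M) i).lintegral_comp hu
    simp only [this, Finset.sum_const, Finset.card_univ, Fintype.card_fin, nsmul_eq_mul]
    rw [mul_right_comm, ENNReal.mul_inv_cancel hn' (by simp), one_mul]
  -- In the infinite case the bound is `⊤` only if its constant is nonzero. This needs `K ≠ 0` and
  -- `C > 0`; the latter follows from a point of `E`, which exists because `F'` is not zero.
  · by_cases htop : ∫⁻ x, ENNReal.ofReal (g x ^ 2) ∂F' = ⊤
    · rw [htop, ENNReal.mul_top]
      · simp
      · refine mul_ne_zero (fun h0 => ?_) (by simp)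
        have hC : 0 < C := by
          obtain ⟨x⟩ : Nonempty E := by
            by_contra hE
            have := not_nonempty_iff.1 hE
            simp [Measure.eq_zero_of_isEmpty F'] at htop
          exact (hpos x).trans_le (hHC x)
        simp only [add_eq_zero, mul_eq_zero, hK, false_or, ENNReal.ofReal_eq_zero] at h0
        exact absurd h0.1 (not_le.2 hC)
    have hme := measurable_smcEstimate (n := n) hg
    have hQm : Measurable fun x => H x * ∫ y, g y ∂(M x) :=
      hH.mul hg.stronglyMeasurable.integral_kernel.measurable
    have hu : Measurable fun x => ENNReal.ofReal (g x ^ 2) := by fun_prop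
    rw [key _ (by fun_prop)]
    have hQint : ∫ x, H x * ∫ y, g y ∂(M x) ∂F = ∫ x, g x ∂F' := by
      have hg2 : Integrable g (M ∘ₘ F') := by
        rw [hM.def]
        exact (memLp_two_of_lintegral_sq_ne_top hg.aestronglyMeasurable htop).integrable
          (by norm_num)
      conv_rhs => rw [← hM.def]
      rw [Measure.comp_eq_comp_const_apply] at hg2 ⊢
      rw [Kernel.integral_comp hg2, Kernel.const_apply, hF,
        integral_withDensity_eq_integral_toReal_smul hH.ennreal_ofReal (by simp)]
      simp [ENNReal.toReal_ofReal (hpos _).le]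
    -- One factor `H` is bounded by `C`; the other is kept as the density of `F'`. Jensen's
    -- inequality for `M` handles the square.
    have hQsq : ∫⁻ x, ENNReal.ofReal ((H x * ∫ y, g y ∂(M x)) ^ 2) ∂F
        ≤ ENNReal.ofReal C * ∫⁻ x, ENNReal.ofReal (g x ^ 2) ∂F' := by
      rw [← hinv _ hu, ← lintegral_const_mul' _ _ ENNReal.ofReal_ne_top]
      refine lintegral_mono fun x => ?_
      rw [mul_pow, ENNReal.ofReal_mul (sq_nonneg _), ← mul_assoc]
      refine mul_le_mul' ?_ (ofReal_sq_integral_le _ hg.aestronglyMeasurable)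
      rw [← ENNReal.ofReal_mul ((hpos x).le.trans (hHC x)), sq]
      exact ENNReal.ofReal_le_ofReal (mul_le_mul_of_nonneg_right (hHC x) (hpos x).le)
    -- Of the squared normalising constant, one factor is bounded by `B C` and the other is
    -- integrated exactly by unbiasedness.
    have hsecond : ∫⁻ s, ENNReal.ofReal ((s.1 * ((∑ i, H (s.2 i)) / n)) ^ 2)
          * ((n : ENNReal)⁻¹ * ∫⁻ x, ENNReal.ofReal (g x ^ 2) ∂((select H hH s.2).bind M)) ∂law
        ≤ ENNReal.ofReal (B * C) * (n : ENNReal)⁻¹ * ∫⁻ x, ENNReal.ofReal (g x ^ 2) ∂F' := by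
      rw [← hunb _ hu, ← lintegral_const_mul' _ _ (ENNReal.mul_ne_top ENNReal.ofReal_ne_top
        (by simpa using hn.ne'))]
      refine lintegral_mono_ae ?_
      filter_upwards [h.bounded] with s hs
      have h1 : 0 ≤ s.1 * ((∑ i, H (s.2 i)) / n) := mul_nonneg hs.1 (hmean_pos _)
      have h2 : s.1 * ((∑ i, H (s.2 i)) / n) ≤ B * C :=
        mul_le_mul hs.2 (hmean_le _) (hmean_pos _) hB
      rw [sq, ENNReal.ofReal_mul h1]
      calc _ = ENNReal.ofReal (s.1 * ((∑ i, H (s.2 i)) / n)) * (n : ENNReal)⁻¹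
            * (ENNReal.ofReal (s.1 * ((∑ i, H (s.2 i)) / n))
              * ∫⁻ x, ENNReal.ofReal (g x ^ 2) ∂((select H hH s.2).bind M)) := by ring
        _ ≤ _ := by gcongr
    calc _ ≤ ∫⁻ s, (ENNReal.ofReal (smcEstimate (fun x => H x * ∫ y, g y ∂(M x)) s ^ 2)
        + ENNReal.ofReal ((s.1 * ((∑ i, H (s.2 i)) / n)) ^ 2)
          * ((n : ENNReal)⁻¹ * ∫⁻ x, ENNReal.ofReal (g x ^ 2) ∂((select H hH s.2).bind M))) ∂law :=
          lintegral_mono fun s => lintegral_sq_smcEstimate_le hH hpos M hn hg s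
      _ = ∫⁻ s, ENNReal.ofReal (smcEstimate (fun x => H x * ∫ y, g y ∂(M x)) s ^ 2) ∂law
        + ∫⁻ s, ENNReal.ofReal ((s.1 * ((∑ i, H (s.2 i)) / n)) ^ 2)
          * ((n : ENNReal)⁻¹ * ∫⁻ x, ENNReal.ofReal (g x ^ 2) ∂((select H hH s.2).bind M)) ∂law :=
          lintegral_add_left (by have := measurable_smcEstimate (n := n) hQm; fun_prop) _
      _ ≤ (ENNReal.ofReal ((∫ x, g x ∂F') ^ 2)
          + K * (n : ENNReal)⁻¹ * (ENNReal.ofReal C * ∫⁻ x, ENNReal.ofReal (g x ^ 2) ∂F'))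
          + ENNReal.ofReal (B * C) * (n : ENNReal)⁻¹ * ∫⁻ x, ENNReal.ofReal (g x ^ 2) ∂F' := by
          refine add_le_add ((h.second_moment _ hQm).trans ?_) hsecond
          rw [hQint]
          gcongr
      _ = _ := by ring

end Sampler

/-! ### Telescoping of mixed differences. -/

theorem corner_le_iff {D : ℕ} (S : Finset (Fin D)) (b c : MultiIndex D) :
    (∃ a ≤ b, Admissible a S ∧ corner a S = c) ↔ c ≤ b ∧ ∀ i ∈ S, c i < b i := by
  constructor
  · rintro ⟨a, ha, hS, rfl⟩
    refine ⟨fun i => ?_, fun i hi => ?_⟩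
    · have hai : a i ≤ b i := ha i
      simp only [corner]
      split_ifs <;> omega
    · have hai : a i ≤ b i := ha i
      have := hS i hi
      simp only [corner, hi, if_true]
      omega
  · rintro ⟨hc, hS⟩
    refine ⟨fun i => if i ∈ S then c i + 1 else c i, fun i => ?_, fun i hi => ?_, ?_⟩
    · have := hc i
      by_cases hi : i ∈ S
      · simpa [hi] using hS i hi
      · simpa [hi] using this
    · simp [hi]
    · funext i
      by_cases hi : i ∈ S <;> simp [corner, hi]

/-- Admissibility is essential: truncated subtraction would identify the entries 0 and 1. -/
theorem corner_injOn {D : ℕ} (S : Finset (Fin D)) :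
    Set.InjOn (fun a : MultiIndex D => corner a S) {a | Admissible a S} := by
  intro a ha a' ha' h
  funext i
  have hi := congrFun h i
  by_cases hS : i ∈ S
  · have := ha i hS
    have := ha' i hS
    simp only [corner, hS, if_true] at hi
    omega
  · simpa [corner, hS] using hi

/-- The mixed differences telescope over a box. -/
theorem sum_Iic_mixedDiff {D : ℕ} (v : MultiIndex D → ℝ) (b : MultiIndex D) :
    ∑ a ∈ Finset.Iic b, mixedDiff v a = v b := by
  simp only [mixedDiff_eq_sum]
  rw [Finset.sum_comm]
  -- Substitute `c = corner a S`: the values reached from the box are those `c ≤ b` strictly below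
  -- `b` in the directions of `S`.
  have h1 : ∀ S : Finset (Fin D),
      (∑ a ∈ Finset.Iic b, if Admissible a S then (-1 : ℝ) ^ S.card * v (corner a S) else 0)
        = ∑ c ∈ Finset.Iic b, if ∀ i ∈ S, c i < b i then (-1 : ℝ) ^ S.card * v c else 0 := by
    intro S
    rw [← Finset.sum_filter, ← Finset.sum_filter]
    refine Finset.sum_nbij (fun a => corner a S) (fun a ha => ?_) (fun a ha a' ha' h => ?_)
      (fun c hc => ?_) (fun a _ => rfl)
    · simp only [Finset.mem_filter, Finset.mem_Iic] at ha ⊢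
      exact (corner_le_iff S b _).1 ⟨a, ha.1, ha.2, rfl⟩
    · simp only [Finset.coe_filter, Set.mem_ofPred_eq] at ha ha'
      exact corner_injOn S ha.2 ha'.2 h
    · simp only [Finset.coe_filter, Set.mem_ofPred_eq, Finset.mem_Iic] at hc
      obtain ⟨a, h1, h2, h3⟩ := (corner_le_iff S b c).2 hc
      exact ⟨a, by simp [h1, h2], h3⟩
  simp only [h1]
  rw [Finset.sum_comm]
  -- The coefficient of `v c` is the alternating sum over subsets of `{i | c i < b i}`, which
  -- vanishes unless that set is empty.
  have h2 : ∀ c ∈ Finset.Iic b,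
      (∑ S : Finset (Fin D), if ∀ i ∈ S, c i < b i then (-1 : ℝ) ^ S.card * v c else 0)
        = if c = b then v c else 0 := by
    intro c hc
    have hcb : c ≤ b := Finset.mem_Iic.1 hc
    have h3 : (∑ S : Finset (Fin D), if ∀ i ∈ S, c i < b i then (-1 : ℝ) ^ S.card * v c else 0)
        = (∑ S ∈ (Finset.univ.filter fun i => c i < b i).powerset, (-1 : ℝ) ^ S.card) * v c := by
      rw [← Finset.sum_filter, Finset.sum_mul]
      refine Finset.sum_congr ?_ fun _ _ => rfl
      ext S
      simp [Finset.subset_iff]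
    have h4 := Finset.sum_powerset_neg_one_pow_card
      (x := Finset.univ.filter fun i => c i < b i)
    have h5 : (∑ S ∈ (Finset.univ.filter fun i => c i < b i).powerset, (-1 : ℝ) ^ S.card)
        = if (Finset.univ.filter fun i => c i < b i) = ∅ then 1 else 0 := by
      exact_mod_cast congrArg (Int.cast : ℤ → ℝ) h4
    rw [h3, h5]
    have h6 : (Finset.univ.filter fun i => c i < b i) = ∅ ↔ c = b := by
      simp only [Finset.filter_eq_empty_iff, Finset.mem_univ, true_implies, not_lt]
      exact ⟨fun h => le_antisymm hcb fun i => h (x := i), fun h i => by rw [h]⟩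
    simp only [h6, ite_mul, one_mul, zero_mul]
  rw [Finset.sum_congr rfl h2]
  simp

/-! ### Mean and variance of the particle estimates. -/

section ParticleMoments

variable {E : Type*} [MeasurableSpace E] {n : ℕ} {law : Measure (ℝ × (Fin n → E))}
  {F : Measure E} {B : ℝ} {K : ENNReal}

theorem IsParticleApprox.memLp (h : IsParticleApprox law F B K) (hn : 0 < n) (hK : K ≠ ⊤)
    {g : E → ℝ} (hg : Measurable g) (hg2 : ∫⁻ x, ENNReal.ofReal (g x ^ 2) ∂F ≠ ⊤) :
    MemLp (smcEstimate g) 2 law := by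
  refine memLp_two_of_lintegral_sq_ne_top (measurable_smcEstimate hg).aestronglyMeasurable ?_
  refine ne_top_of_le_ne_top ?_ (h.second_moment g hg)
  refine ENNReal.add_ne_top.2 ⟨ENNReal.ofReal_ne_top, ENNReal.mul_ne_top
    (ENNReal.mul_ne_top hK ?_) hg2⟩
  simpa using hn.ne'

theorem IsParticleApprox.integral_of_nonneg (h : IsParticleApprox law F B K) {g : E → ℝ}
    (hg : Measurable g) (hg0 : ∀ x, 0 ≤ g x) :
    ∫ s, smcEstimate g s ∂law = ∫ x, g x ∂F := by
  have hpos : ∀ᵐ s ∂law, 0 ≤ smcEstimate g s := by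
    filter_upwards [h.bounded] with s hs
    exact mul_nonneg hs.1 (div_nonneg (Finset.sum_nonneg fun i _ => hg0 _) n.cast_nonneg)
  rw [integral_eq_lintegral_of_nonneg_ae hpos (measurable_smcEstimate hg).aestronglyMeasurable,
    integral_eq_lintegral_of_nonneg_ae (ae_of_all _ hg0) hg.aestronglyMeasurable,
    ← h.unbiased _ hg.ennreal_ofReal]
  congr 1
  refine lintegral_congr_ae ?_
  filter_upwards [h.bounded] with s hs
  rw [smcEstimate, ENNReal.ofReal_mul hs.1]
  congr 1
  rcases Nat.eq_zero_or_pos n with rfl | hn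
  · simp
  rw [ENNReal.ofReal_div_of_pos (by exact_mod_cast hn), ENNReal.ofReal_natCast,
    ENNReal.ofReal_sum_of_nonneg fun i _ => hg0 _]

/-- Unbiasedness is available for functions with values in `[0, ∞]`; signed functions are split into
positive and negative parts, both square integrable. -/
theorem IsParticleApprox.integral_eq [IsProbabilityMeasure law] [IsFiniteMeasure F]
    (h : IsParticleApprox law F B K) (hn : 0 < n) (hK : K ≠ ⊤)
    {g : E → ℝ} (hg : Measurable g) (hg2 : ∫⁻ x, ENNReal.ofReal (g x ^ 2) ∂F ≠ ⊤) :
    ∫ s, smcEstimate g s ∂law = ∫ x, g x ∂F := by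
  have hle : ∀ u : E → ℝ, (∀ x, u x ^ 2 ≤ g x ^ 2) →
      ∫⁻ x, ENNReal.ofReal (u x ^ 2) ∂F ≠ ⊤ := fun u hu =>
    ne_top_of_le_ne_top hg2 (lintegral_mono fun x => ENNReal.ofReal_le_ofReal (hu x))
  have hp : ∀ x, max (g x) 0 ^ 2 ≤ g x ^ 2 := fun x => by
    rcases le_total (g x) 0 with h0 | h0 <;> simp [h0, sq_nonneg]
  have hq : ∀ x, max (-g x) 0 ^ 2 ≤ g x ^ 2 := fun x => by
    rcases le_total (g x) 0 with h0 | h0 <;> simp [h0]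
  have hpm : Measurable fun x => max (g x) 0 := hg.max measurable_const
  have hqm : Measurable fun x => max (-g x) 0 := hg.neg.max measurable_const
  have hsub : ∀ x, g x = max (g x) 0 - max (-g x) 0 := fun x => by
    rcases le_total (g x) 0 with h0 | h0 <;> simp [h0]
  have hest : ∀ s : ℝ × (Fin n → E), smcEstimate g s
      = smcEstimate (fun x => max (g x) 0) s - smcEstimate (fun x => max (-g x) 0) s := fun s => by
    simp only [smcEstimate]
    rw [← mul_sub, ← sub_div, ← Finset.sum_sub_distrib]
    simp only [← hsub]
  calc ∫ s, smcEstimate g s ∂law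
      = ∫ s, (smcEstimate (fun x => max (g x) 0) s - smcEstimate (fun x => max (-g x) 0) s) ∂law :=
        integral_congr_ae (ae_of_all _ hest)
    _ = ∫ x, max (g x) 0 ∂F - ∫ x, max (-g x) 0 ∂F := by
        rw [integral_sub ((h.memLp hn hK hpm (hle _ hp)).integrable (by norm_num))
          ((h.memLp hn hK hqm (hle _ hq)).integrable (by norm_num)),
          h.integral_of_nonneg hpm fun x => le_max_right _ _,
          h.integral_of_nonneg hqm fun x => le_max_right _ _]
    _ = ∫ x, g x ∂F := by
        rw [← integral_sub ((memLp_two_of_lintegral_sq_ne_top hpm.aestronglyMeasurable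
          (hle _ hp)).integrable (by norm_num)) ((memLp_two_of_lintegral_sq_ne_top
          hqm.aestronglyMeasurable (hle _ hq)).integrable (by norm_num))]
        simp only [← hsub]

/-- By unbiasedness the squared mean equals the leading term of the second moment bound, so
subtracting it leaves only the `1/n` term. -/
theorem IsParticleApprox.variance_le [IsProbabilityMeasure law] [IsFiniteMeasure F]
    (h : IsParticleApprox law F B K) (hn : 0 < n) (hK : K ≠ ⊤)
    {g : E → ℝ} (hg : Measurable g) {V : ℝ}
    (hg2 : K * ∫⁻ x, ENNReal.ofReal (g x ^ 2) ∂F ≤ ENNReal.ofReal V) (hV : 0 ≤ V)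
    (hfin : ∫⁻ x, ENNReal.ofReal (g x ^ 2) ∂F ≠ ⊤) :
    Var[smcEstimate g; law] ≤ V / n := by
  have h1 := lintegral_sq_sub_eq (h.memLp hn hK hg hfin) 0
  have h2 := h.second_moment g hg
  simp only [sub_zero] at h1
  rw [h1, h.integral_eq hn hK hg hfin, add_comm,
    ENNReal.add_le_add_iff_left ENNReal.ofReal_ne_top] at h2
  have hn0 : (0 : ℝ) < n := by exact_mod_cast hn
  refine (ENNReal.ofReal_le_ofReal_iff (div_nonneg hV hn0.le)).1 (h2.trans ?_)
  rw [mul_right_comm, ENNReal.ofReal_div_of_pos hn0, ENNReal.ofReal_natCast, div_eq_mul_inv]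
  gcongr

end ParticleMoments

/-! ### Uniform control of the intermediate measures. -/

namespace Problem

variable {D : ℕ} {X : Type*} [MeasurableSpace X] (P : Problem D X)

/-- The density at stage `j` is the initial one times `j` potentials, hence the exponent `j + 1`. -/
theorem dens_le {C : ℝ} (hC : 0 ≤ C) (h0 : ∀ α x, P.dens α 0 x ≤ C)
    (hH : ∀ α x, ∀ j < P.J, P.H α j x ≤ C) (α : MultiIndex D) (x : Coupled D X) :
    ∀ j ≤ P.J, P.dens α j x ≤ C ^ (j + 1) := by
  intro j
  induction j with
  | zero => intro _; simpa using h0 α x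
  | succ j ih =>
    intro hj
    have h := hH α x j hj
    rw [H, div_le_iff₀ (P.dens_pos _ _ _)] at h
    refine h.trans ?_
    rw [pow_succ' C (j + 1)]
    exact mul_le_mul_of_nonneg_left (ih (Nat.le_of_succ_le hj)) hC

theorem le_dens {c : ℝ} (hc : 0 ≤ c) (h0 : ∀ α x, c ≤ P.dens α 0 x)
    (hH : ∀ α x, ∀ j < P.J, c ≤ P.H α j x) (α : MultiIndex D) (x : Coupled D X) :
    ∀ j ≤ P.J, c ^ (j + 1) ≤ P.dens α j x := by
  intro j
  induction j with
  | zero => intro _; simpa using h0 α x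
  | succ j ih =>
    intro hj
    have h := hH α x j hj
    rw [H, le_div_iff₀ (P.dens_pos _ _ _)] at h
    refine le_trans ?_ h
    rw [pow_succ' c (j + 1)]
    exact mul_le_mul_of_nonneg_left (ih (Nat.le_of_succ_le hj)) hc

theorem interm_succ (α : MultiIndex D) (j : ℕ) :
    P.interm α (j + 1) = (P.interm α j).withDensity fun x => ENNReal.ofReal (P.H α j x) := by
  rw [interm, interm, ← withDensity_mul _ (P.dens_measurable α j).ennreal_ofReal
    (P.H_measurable α j).ennreal_ofReal]
  congr 1
  funext x
  rw [Pi.mul_apply, ← ENNReal.ofReal_mul (P.dens_pos _ _ _).le, H,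
    mul_div_cancel₀ _ (P.dens_pos _ _ _).ne']

theorem measurable_diagonal : Measurable fun (x : X) (_ : Finset (Fin D)) => x :=
  measurable_pi_lambda _ fun _ => measurable_id

instance : IsProbabilityMeasure (coupledPrior D P.prior) :=
  Measure.isProbabilityMeasure_map measurable_diagonal.aemeasurable

theorem isFiniteMeasure_interm {C : ℝ} (α : MultiIndex D) (j : ℕ) (h : ∀ x, P.dens α j x ≤ C) :
    IsFiniteMeasure (P.interm α j) := by
  refine ⟨?_⟩
  rw [interm, withDensity_apply _ MeasurableSet.univ, Measure.restrict_univ]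
  refine (lintegral_mono fun x => ENNReal.ofReal_le_ofReal (h x)).trans_lt ?_
  simp

/-- The sampler approximates its intermediate measures, uniformly in the multi-index and in the
number of particles. -/
theorem exists_isParticleApprox {C : ℝ} (hC : 0 < C) (h0 : ∀ α x, P.dens α 0 x ≤ C)
    (hH : ∀ α x, ∀ j < P.J, P.H α j x ≤ C) :
    ∀ j ≤ P.J, ∃ K : ENNReal, K ≠ 0 ∧ K ≠ ⊤ ∧ ∀ α n, 0 < n →
      IsParticleApprox (P.smcLawAt α n j) (P.interm α j) (C ^ j) K := by
  intro j
  induction j with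
  | zero =>
    intro _
    refine ⟨1, one_ne_zero, ENNReal.one_ne_top, fun α n hn => ?_⟩
    simpa [smcLawAt] using isParticleApprox_init hn (P.interm α 0)
  | succ j ih =>
    intro hj
    obtain ⟨K, hK0, hKt, hK⟩ := ih (Nat.le_of_succ_le hj)
    refine ⟨K * ENNReal.ofReal C + ENNReal.ofReal (C ^ j * C), ?_, ?_, fun α n hn => ?_⟩
    · have : 0 < C ^ j * C := by positivity
      simp [this]
    · exact ENNReal.add_ne_top.2 ⟨ENNReal.mul_ne_top hKt ENNReal.ofReal_ne_top,
        ENNReal.ofReal_ne_top⟩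
    · have := P.isFiniteMeasure_interm α (j + 1) fun x => P.dens_le hC.le h0 hH α x _ hj
      rw [pow_succ]
      exact (hK α n hn).step (P.H_measurable α j) (P.H_pos α j) (P.M α (j + 1)) hn
        (pow_nonneg hC.le _) (fun x => hH α x j hj) (P.interm_succ α j)
        (P.M_invariant α (j + 1) (by omega) hj) hK0

/-! ### Increments: from the coupled space back to the prior. -/

section Increment

variable {ζ : MultiIndex D → X → ℝ}

theorem measurable_mixedDiff (hζ : ∀ α, Measurable (ζ α)) (α : MultiIndex D) :
    Measurable fun x => mixedDiff (fun a => P.Lα a x * ζ a x) α := by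
  simp only [mixedDiff_eq_sum]
  refine Finset.measurable_sum _ fun S _ => ?_
  split_ifs
  · exact ((P.Lα_measurable _).mul (hζ _)).const_mul _
  · exact measurable_const

theorem measurable_psi (hζ : ∀ α, Measurable (ζ α)) (α : MultiIndex D) :
    Measurable (psi P.Lα ζ α) := by
  have h1 : Measurable (coupledLik P.Lα α) := by
    have : coupledLik P.Lα α = P.dens α P.J := funext fun x => (P.dens_last α x).symm
    rw [this]
    exact P.dens_measurable α P.J
  unfold psi
  refine Finset.measurable_sum _ fun S _ => ?_
  refine Measurable.mul (Measurable.const_mul (Measurable.div ?_ h1) _)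
    ((hζ _).comp (measurable_pi_apply S))
  unfold cornerLik
  split_ifs
  · exact (P.Lα_measurable _).comp (measurable_pi_apply S)
  · exact measurable_const

/-- The final density is the common denominator of the weights in `psi`, nonzero by `dens_pos`. The
diagonal suffices because the coupled prior is carried by it. -/
theorem dens_mul_psi_diagonal (α : MultiIndex D) (x : X) :
    P.dens α P.J (fun _ => x) * psi P.Lα ζ α (fun _ => x)
      = mixedDiff (fun a => P.Lα a x * ζ a x) α := by
  have h : coupledLik P.Lα α (fun _ => x) ≠ 0 := by
    rw [← P.dens_last]
    exact (P.dens_pos _ _ _).ne'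
  rw [P.dens_last, psi, Finset.mul_sum, mixedDiff_eq_sum]
  refine Finset.sum_congr rfl fun S _ => ?_
  rw [cornerLik]
  split_ifs
  · field_simp
  · simp

theorem lintegral_interm (α : MultiIndex D) (j : ℕ) {u : Coupled D X → ENNReal}
    (hu : Measurable u) :
    ∫⁻ x, u x ∂(P.interm α j)
      = ∫⁻ x, ENNReal.ofReal (P.dens α j fun _ => x) * u (fun _ => x) ∂P.prior := by
  have h := (P.dens_measurable α j).ennreal_ofReal
  rw [interm, lintegral_withDensity_eq_lintegral_mul _ h hu, coupledPrior,
    lintegral_map (h.mul hu) measurable_diagonal]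
  rfl

theorem integral_interm_psi (hζ : ∀ α, Measurable (ζ α)) (α : MultiIndex D) :
    ∫ x, psi P.Lα ζ α x ∂(P.interm α P.J)
      = ∫ x, mixedDiff (fun a => P.Lα a x * ζ a x) α ∂P.prior := by
  rw [interm, integral_withDensity_eq_integral_toReal_smul
    (P.dens_measurable α P.J).ennreal_ofReal (by simp), coupledPrior, integral_map
    measurable_diagonal.aemeasurable]
  · refine integral_congr_ae (ae_of_all _ fun x => ?_)
    simp only [smul_eq_mul]
    rw [ENNReal.toReal_ofReal (P.dens_pos _ _ _).le, P.dens_mul_psi_diagonal]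
  · exact ((P.dens_measurable α P.J).ennreal_ofReal.ennreal_toReal.smul
      (P.measurable_psi hζ α)).aestronglyMeasurable

/-- On the diagonal, density times `ψ²` is the squared mixed difference divided by the density,
which is at least `c`. -/
theorem lintegral_interm_psi_sq_le (hζ : ∀ α, Measurable (ζ α)) {c : ℝ} (hc : 0 < c)
    (hdens : ∀ α x, c ≤ P.dens α P.J x) (α : MultiIndex D) :
    ∫⁻ x, ENNReal.ofReal (psi P.Lα ζ α x ^ 2) ∂(P.interm α P.J)
      ≤ ENNReal.ofReal c⁻¹
        * ∫⁻ x, ENNReal.ofReal (mixedDiff (fun a => P.Lα a x * ζ a x) α ^ 2) ∂P.prior := by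
  have hm := P.measurable_psi hζ α
  rw [P.lintegral_interm α P.J (by fun_prop), ← lintegral_const_mul' _ _ ENNReal.ofReal_ne_top]
  refine lintegral_mono fun x => ?_
  dsimp only
  rw [← P.dens_mul_psi_diagonal, ← ENNReal.ofReal_mul (P.dens_pos _ _ _).le,
    ← ENNReal.ofReal_mul (inv_nonneg.2 hc.le)]
  refine ENNReal.ofReal_le_ofReal ?_
  have h1 := hdens α fun _ => x
  have h2 := P.dens_pos α P.J fun _ => x
  rw [mul_pow, sq (P.dens _ _ _), ← mul_assoc, ← mul_assoc]
  refine mul_le_mul_of_nonneg_right ?_ (sq_nonneg _)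
  refine le_mul_of_one_le_left h2.le ?_
  rw [inv_mul_eq_div, one_le_div hc]
  exact h1

theorem memLp_mixedDiff {β : Fin D → ℝ} (hζ : ∀ α, Measurable (ζ α)) (hV : P.VarianceRate ζ β)
    (α : MultiIndex D) : MemLp (fun x => mixedDiff (fun a => P.Lα a x * ζ a x) α) 2 P.prior := by
  obtain ⟨C, -, h⟩ := hV
  exact (memLp_two_iff_integrable_sq (P.measurable_mixedDiff hζ α).aestronglyMeasurable).2 (h α).1

/-- The increments sum to the approximate target over a box. -/
theorem sum_integral_mixedDiff {β : Fin D → ℝ} (hζ : ∀ α, Measurable (ζ α))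
    (hV : P.VarianceRate ζ β) (b : MultiIndex D) :
    ∑ a ∈ Finset.Iic b, ∫ x, mixedDiff (fun a => P.Lα a x * ζ a x) a ∂P.prior
      = P.fα b (ζ b) := by
  rw [← integral_finsetSum _ fun a _ => (P.memLp_mixedDiff hζ hV a).integrable (by norm_num), fα]
  refine integral_congr_ae (ae_of_all _ fun x => ?_)
  simp only [sum_Iic_mixedDiff]
  ring

/-- Uniform moment bounds for the estimates of the increments. -/
theorem exists_increment_bounds (hG : P.BoundedPotentials) {β : Fin D → ℝ}
    (hζ : ∀ α, Measurable (ζ α)) (hV : P.VarianceRate ζ β) :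
    ∃ C : ℝ, 0 < C ∧ ∀ α,
      (∫ x, mixedDiff (fun a => P.Lα a x * ζ a x) α ∂P.prior) ^ 2
          ≤ C * ∏ i, (2 : ℝ) ^ (-(α i : ℝ) * β i) ∧
      ∀ n, 0 < n → MemLp (smcEstimate (psi P.Lα ζ α)) 2 (P.smcLaw α n) ∧
        ∫ s, smcEstimate (psi P.Lα ζ α) s ∂(P.smcLaw α n)
          = ∫ x, mixedDiff (fun a => P.Lα a x * ζ a x) α ∂P.prior ∧
        Var[smcEstimate (psi P.Lα ζ α); P.smcLaw α n]
          ≤ (C * ∏ i, (2 : ℝ) ^ (-(α i : ℝ) * β i)) / n := by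
  have hLp := P.memLp_mixedDiff hζ hV
  obtain ⟨B, hB, -, -, h0, hH⟩ := hG
  obtain ⟨V, hVpos, hV⟩ := hV
  obtain ⟨K, hK0, hKt, hK⟩ := P.exists_isParticleApprox hB (fun α x => (h0 α x).2)
    (fun α x j hj => (hH α x j hj).2) P.J le_rfl
  have hdens := fun α x => P.le_dens (inv_nonneg.2 hB.le) (fun α x => (h0 α x).1.le)
    (fun α x j hj => (hH α x j hj).1.le) α x P.J le_rfl
  set c := B⁻¹ ^ (P.J + 1) with hc
  have hcpos : 0 < c := by positivity
  have hprod : ∀ α : MultiIndex D, 0 < ∏ i, (2 : ℝ) ^ (-(α i : ℝ) * β i) := fun α =>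
    Finset.prod_pos fun i _ => by positivity
  have hsq : ∀ α, ∫⁻ x, ENNReal.ofReal (mixedDiff (fun a => P.Lα a x * ζ a x) α ^ 2) ∂P.prior
      ≤ ENNReal.ofReal (V * ∏ i, (2 : ℝ) ^ (-(α i : ℝ) * β i)) := fun α => by
    rw [← ofReal_integral_eq_lintegral_ofReal (hV α).1 (ae_of_all _ fun x => sq_nonneg _)]
    exact ENNReal.ofReal_le_ofReal (hV α).2
  -- The first summand serves the squared mean, the second the variance.
  refine ⟨V + K.toReal * c⁻¹ * V, by positivity, fun α => ⟨?_, fun n hn => ?_⟩⟩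
  · have h1 := (ofReal_sq_integral_le P.prior (hLp α).1).trans (hsq α)
    rw [ENNReal.ofReal_le_ofReal_iff (mul_pos hVpos (hprod α)).le] at h1
    refine h1.trans (mul_le_mul_of_nonneg_right ?_ (hprod α).le)
    have : 0 ≤ K.toReal * c⁻¹ * V := by positivity
    linarith
  · have hfinI := P.isFiniteMeasure_interm α P.J fun x => P.dens_le hB.le (fun α x => (h0 α x).2)
      (fun α x j hj => (hH α x j hj).2) α x _ le_rfl
    have hbound := (P.lintegral_interm_psi_sq_le hζ hcpos hdens α).trans
      (mul_le_mul_right (hsq α) _)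
    have hfin := ne_top_of_le_ne_top
      (ENNReal.mul_ne_top ENNReal.ofReal_ne_top ENNReal.ofReal_ne_top) hbound
    have hA := hK α n hn
    refine ⟨hA.memLp hn hKt (P.measurable_psi hζ α) hfin, ?_, ?_⟩
    · rw [← P.integral_interm_psi hζ]
      exact hA.integral_eq hn hKt (P.measurable_psi hζ α) hfin
    · refine hA.variance_le hn hKt (P.measurable_psi hζ α) ?_
        (mul_nonneg (by positivity) (hprod α).le) hfin
      refine (mul_le_mul_right hbound K).trans ?_
      rw [← ENNReal.ofReal_mul (inv_nonneg.2 hcpos.le)]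
      conv_lhs => rw [← ENNReal.ofReal_toReal hKt]
      rw [← ENNReal.ofReal_mul ENNReal.toReal_nonneg]
      refine ENNReal.ofReal_le_ofReal ?_
      have := mul_pos hVpos (hprod α)
      nlinarith

end Increment

end Problem

/-! ### Mean square error of the randomized sum. -/

/-- Bias-variance decomposition for a sum of pairwise independent terms. -/
theorem lintegral_sq_sum_sub_eq {Ω ι : Type*} [MeasurableSpace Ω] {μ : Measure Ω}
    [IsProbabilityMeasure μ] {s : Finset ι} {Y : ι → Ω → ℝ} (hY : ∀ i ∈ s, MemLp (Y i) 2 μ)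
    (hind : Set.Pairwise ↑s fun i j => Y i ⟂ᵢ[μ] Y j) (a : ℝ) :
    ∫⁻ ω, ENNReal.ofReal ((∑ i ∈ s, Y i ω - a) ^ 2) ∂μ
      = ENNReal.ofReal (∑ i ∈ s, Var[Y i; μ])
        + ENNReal.ofReal ((∑ i ∈ s, ∫ ω, Y i ω ∂μ - a) ^ 2) := by
  rw [lintegral_sq_sub_eq (memLp_finsetSum s hY),
    integral_finsetSum s fun i hi => (hY i hi).integrable (by norm_num),
    ← IndepFun.variance_sum hY hind]
  congr 3
  ext ω
  simp

theorem lintegral_pmf {ι : Type*} [MeasurableSpace ι] [Countable ι] [MeasurableSingletonClass ι]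
    (p : PMF ι) (u : ι → ENNReal) : ∫⁻ x, u x ∂p.toMeasure = ∑' x, u x * p x := by
  rw [lintegral_countable']
  simp only [PMF.toMeasure_apply_singleton _ _ (measurableSet_singleton _)]

namespace Problem

variable {D : ℕ} {X : Type*} [MeasurableSpace X] (P : Problem D X)

theorem count_eq_zero {Nmin m : ℕ} {A : Fin m → MultiIndex D} {α : MultiIndex D}
    (h : α ∉ Finset.univ.image A) : count Nmin A α = 0 := by
  simp only [Finset.mem_image, Finset.mem_univ, true_and, not_exists] at h
  simp [count, h]

theorem count_pos {Nmin m : ℕ} (hN : 0 < Nmin) {A : Fin m → MultiIndex D} {α : MultiIndex D}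
    (h : α ∈ Finset.univ.image A) : 0 < count Nmin A α := by
  refine Nat.mul_pos hN (Finset.card_pos.2 ?_)
  obtain ⟨i, -, hi⟩ := Finset.mem_image.1 h
  exact ⟨i, by simp [hi]⟩

theorem sum_count_mul (Nmin : ℕ) {m : ℕ} (A : Fin m → MultiIndex D) (h : MultiIndex D → ℝ) :
    ∑ α ∈ Finset.univ.image A, (count Nmin A α : ℝ) * h α = Nmin * ∑ i, h (A i) := by
  rw [Finset.sum_comp h A, Finset.mul_sum]
  refine Finset.sum_congr rfl fun α _ => ?_
  simp [count, mul_assoc]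

theorem Fhat_eq_sum (p : PMF (MultiIndex D)) (Nmin m : ℕ) (ζ : MultiIndex D → X → ℝ)
    (ω : Sample D X m) :
    P.Fhat p Nmin m ζ ω = ∑ α ∈ Finset.univ.image ω.1,
      (count Nmin ω.1 α : ℝ) / (((m * Nmin : ℕ) : ℝ) * (p α).toReal) *
        smcEstimate (psi P.Lα ζ α) (ω.2 (α, count Nmin ω.1 α)) :=
  tsum_eq_sum fun α hα => by
    rw [count_eq_zero hα]
    simp

theorem totalCost_eq_sum (cost : MultiIndex D → ℝ) (Nmin : ℕ) {m : ℕ}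
    (A : Fin m → MultiIndex D) : totalCost cost Nmin A = Nmin * ∑ i, cost (A i) := by
  rw [← sum_count_mul, totalCost]
  exact tsum_eq_sum fun α hα => by rw [count_eq_zero hα]; simp

theorem measurable_Fhat (p : PMF (MultiIndex D)) (Nmin m : ℕ) {ζ : MultiIndex D → X → ℝ}
    (hζ : ∀ α, Measurable (ζ α)) : Measurable (P.Fhat p Nmin m ζ) := by
  refine measurable_from_prod_countable_right fun A => ?_
  simp only [Fhat_eq_sum]
  refine Finset.measurable_sum _ fun α _ => Measurable.const_mul ?_ _
  exact (measurable_smcEstimate (P.measurable_psi hζ α)).comp (measurable_pi_apply _)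

section MeanSquare

variable {ζ : MultiIndex D → X → ℝ} {g V : MultiIndex D → ℝ}

/-- Mean square error of the estimator given the drawn multi-indices. -/
theorem lintegral_sq_Fhat_sub_given_draws_le (p : PMF (MultiIndex D)) (hp : ∀ α, p α ≠ 0)
    {Nmin m : ℕ} (hN : 0 < Nmin) (hm : 0 < m) (hζ : ∀ α, Measurable (ζ α))
    (hY : ∀ α n, 0 < n → MemLp (smcEstimate (psi P.Lα ζ α)) 2 (P.smcLaw α n))
    (hmean : ∀ α n, 0 < n → ∫ s, smcEstimate (psi P.Lα ζ α) s ∂(P.smcLaw α n) = g α)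
    (hvar : ∀ α n, 0 < n → Var[smcEstimate (psi P.Lα ζ α); P.smcLaw α n] ≤ V α / n)
    (a : ℝ) (A : Fin m → MultiIndex D) :
    ∫⁻ r, ENNReal.ofReal ((P.Fhat p Nmin m ζ (A, r) - a) ^ 2)
        ∂(Measure.infinitePi fun q : MultiIndex D × ℕ => P.smcLaw q.1 q.2)
      ≤ ENNReal.ofReal ((∑ i, V (A i) / (p (A i)).toReal ^ 2) / (m ^ 2 * Nmin))
        + ENNReal.ofReal (((∑ i, g (A i) / (p (A i)).toReal) / m - a) ^ 2) := by
  have hp0 : ∀ α, 0 < (p α).toReal := fun α => ENNReal.toReal_pos (hp α) (p.apply_ne_top α)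
  have hm0 : (0 : ℝ) < m := by exact_mod_cast hm
  have hN0 : (0 : ℝ) < Nmin := by exact_mod_cast hN
  set μ := Measure.infinitePi fun q : MultiIndex D × ℕ => P.smcLaw q.1 q.2 with hμ
  set c : MultiIndex D → ℝ := fun α =>
    (count Nmin A α : ℝ) / (((m * Nmin : ℕ) : ℝ) * (p α).toReal) with hc
  set Y : MultiIndex D → ((q : MultiIndex D × ℕ) → ℝ × (Fin q.2 → Coupled D X)) → ℝ :=
    fun α r => c α * smcEstimate (psi P.Lα ζ α) (r (α, count Nmin A α)) with hYdef
  have hmp : ∀ α, MeasurePreserving (fun r : (q : MultiIndex D × ℕ) → _ =>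
      r (α, count Nmin A α)) μ (P.smcLaw α (count Nmin A α)) := fun α =>
    measurePreserving_eval_infinitePi (fun q : MultiIndex D × ℕ => P.smcLaw q.1 q.2)
      (α, count Nmin A α)
  have hme : ∀ α n, Measurable (smcEstimate (n := n) (psi P.Lα ζ α)) := fun α n =>
    measurable_smcEstimate (P.measurable_psi hζ α)
  -- With the draws frozen, `α ↦ (α, N_α)` is injective, so distinct multi-indices use distinct,
  -- independent runs.
  have hind : iIndepFun (fun α => Y α) μ :=
    (iIndepFun_infinitePi (P := fun q : MultiIndex D × ℕ => P.smcLaw q.1 q.2)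
      (X := fun q r => c q.1 * smcEstimate (psi P.Lα ζ q.1) r)
      fun q => (hme q.1 q.2).const_mul _).precomp (g := fun α => (α, count Nmin A α))
      fun α α' h => congrArg Prod.fst h
  have hcount : ∀ α ∈ Finset.univ.image A, 0 < count Nmin A α := fun α hα => count_pos hN hα
  have hYL : ∀ α ∈ Finset.univ.image A, MemLp (Y α) 2 μ := fun α hα =>
    ((hY α _ (hcount α hα)).comp_measurePreserving (hmp α)).const_mul _
  have hYm : ∀ α ∈ Finset.univ.image A, ∫ r, Y α r ∂μ = c α * g α := fun α hα => by
    rw [integral_const_mul, ← hmean α _ (hcount α hα), ← (hmp α).map_eq,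
      integral_map (hmp α).measurable.aemeasurable (hme α _).aestronglyMeasurable]
  have hYv : ∀ α ∈ Finset.univ.image A, Var[Y α; μ] ≤ c α ^ 2 * (V α / count Nmin A α) :=
    fun α hα => by
      rw [variance_const_mul,
        (hmp α).variance_fun_comp (hme α _).aemeasurable]
      exact mul_le_mul_of_nonneg_left (hvar α _ (hcount α hα)) (sq_nonneg _)
  have hF : ∀ r, P.Fhat p Nmin m ζ (A, r) = ∑ α ∈ Finset.univ.image A, Y α r := fun r =>
    P.Fhat_eq_sum p Nmin m ζ (A, r)
  simp only [hF]
  rw [lintegral_sq_sum_sub_eq hYL (fun i _ j _ hij => hind.indepFun hij)]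
  refine add_le_add (ENNReal.ofReal_le_ofReal ?_) (le_of_eq ?_)
  · refine (Finset.sum_le_sum hYv).trans (le_of_eq ?_)
    -- As `c α` is proportional to `N_α`, the term `c α ^ 2 V α / N_α` is linear in `N_α`, and the
    -- sum over distinct values becomes a sum over draws.
    have h1 := sum_count_mul Nmin A fun α => V α / (p α).toReal ^ 2 / ((m : ℝ) * Nmin) ^ 2
    calc ∑ α ∈ Finset.univ.image A, c α ^ 2 * (V α / count Nmin A α)
        = ∑ α ∈ Finset.univ.image A,
            (count Nmin A α : ℝ) * (V α / (p α).toReal ^ 2 / ((m : ℝ) * Nmin) ^ 2) := by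
          refine Finset.sum_congr rfl fun α hα => ?_
          have h2 : (0 : ℝ) < count Nmin A α := by exact_mod_cast hcount α hα
          have h3 := hp0 α
          simp only [hc]
          push_cast
          field_simp
      _ = _ := by
          rw [h1, ← Finset.sum_div]
          field_simp
  · congr 3
    rw [Finset.sum_congr rfl hYm]
    have h1 := sum_count_mul Nmin A fun α => g α / (p α).toReal / ((m : ℝ) * Nmin)
    calc ∑ α ∈ Finset.univ.image A, c α * g α
        = ∑ α ∈ Finset.univ.image A,
            (count Nmin A α : ℝ) * (g α / (p α).toReal / ((m : ℝ) * Nmin)) := by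
          refine Finset.sum_congr rfl fun α hα => ?_
          have h3 := hp0 α
          simp only [hc]
          push_cast
          field_simp
      _ = _ := by
          rw [h1, ← Finset.sum_div]
          field_simp

/-- Mean square error of the estimator of an unnormalised integral. -/
theorem lintegral_sq_Fhat_sub_le (p : PMF (MultiIndex D)) (hp : ∀ α, p α ≠ 0)
    {Nmin m : ℕ} (hN : 0 < Nmin) (hm : 0 < m) (hζ : ∀ α, Measurable (ζ α))
    (hY : ∀ α n, 0 < n → MemLp (smcEstimate (psi P.Lα ζ α)) 2 (P.smcLaw α n))
    (hmean : ∀ α n, 0 < n → ∫ s, smcEstimate (psi P.Lα ζ α) s ∂(P.smcLaw α n) = g α)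
    (hvar : ∀ α n, 0 < n → Var[smcEstimate (psi P.Lα ζ α); P.smcLaw α n] ≤ V α / n)
    (hg : ∀ α, g α ^ 2 ≤ V α) (hS : Summable fun α => V α / (p α).toReal) {a : ℝ}
    (ha : HasSum g a) :
    ∫⁻ ω, ENNReal.ofReal ((P.Fhat p Nmin m ζ ω - a) ^ 2) ∂(P.sampleLaw p m)
      ≤ 2 * (m : ENNReal)⁻¹ * ∑' α, ENNReal.ofReal (V α / (p α).toReal) := by
  have hp0 : ∀ α, 0 < (p α).toReal := fun α => ENNReal.toReal_pos (hp α) (p.apply_ne_top α)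
  have hm0 : (0 : ℝ) < m := by exact_mod_cast hm
  have hN1 : (1 : ℝ) ≤ Nmin := by exact_mod_cast hN
  have hV : ∀ α, 0 ≤ V α := fun α => (sq_nonneg _).trans (hg α)
  have hofp : ∀ α (v : ℝ), 0 ≤ v → ENNReal.ofReal (v / (p α).toReal ^ 2) * p α
      = ENNReal.ofReal (v / (p α).toReal) := fun α v hv => by
    conv_lhs => rw [← ENNReal.ofReal_toReal (p.apply_ne_top α)]
    have h3 := hp0 α
    rw [ENNReal.toReal_ofReal h3.le, ← ENNReal.ofReal_mul (by positivity)]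
    congr 1
    field_simp
  have hsq : ∫⁻ α, ENNReal.ofReal ((g α / (p α).toReal) ^ 2) ∂p.toMeasure
      ≤ ∑' α, ENNReal.ofReal (V α / (p α).toReal) := by
    rw [lintegral_pmf]
    refine ENNReal.tsum_le_tsum fun α => ?_
    rw [div_pow, hofp α _ (sq_nonneg _)]
    exact ENNReal.ofReal_le_ofReal (div_le_div_of_nonneg_right (hg α) (hp0 α).le)
  have hmeas := P.measurable_Fhat p Nmin m hζ
  rw [sampleLaw, lintegral_prod _ (by fun_prop)]
  refine (lintegral_mono fun A =>
    P.lintegral_sq_Fhat_sub_given_draws_le p hp hN hm hζ hY hmean hvar a A).trans ?_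
  rw [lintegral_add_left (by fun_prop), mul_assoc, two_mul]
  -- The factor 2 counts two equal bounds: the noise of the runs, where `1 / N_min ≤ 1` is dropped,
  -- and the noise of the draws, an empirical mean of `g / p` with expectation `a`.
  refine add_le_add ?_ ?_
  · calc ∫⁻ A : Fin m → MultiIndex D,
          ENNReal.ofReal ((∑ i, V (A i) / (p (A i)).toReal ^ 2) / (m ^ 2 * Nmin))
            ∂(Measure.pi fun _ => p.toMeasure)
        ≤ ∫⁻ A : Fin m → MultiIndex D, ((m : ENNReal) ^ 2)⁻¹
            * ∑ i, ENNReal.ofReal (V (A i) / (p (A i)).toReal ^ 2)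
              ∂(Measure.pi fun _ => p.toMeasure) := by
          refine lintegral_mono fun A => ?_
          have h0 : ∀ i, 0 ≤ V (A i) / (p (A i)).toReal ^ 2 := fun i =>
            div_nonneg (hV _) (sq_nonneg _)
          rw [← ENNReal.ofReal_sum_of_nonneg fun i _ => h0 i, ← ENNReal.ofReal_natCast,
            ← ENNReal.ofReal_pow hm0.le, ← ENNReal.ofReal_inv_of_pos (by positivity),
            ← ENNReal.ofReal_mul (by positivity), inv_mul_eq_div]
          refine ENNReal.ofReal_le_ofReal (div_le_div_of_nonneg_left
            (Finset.sum_nonneg fun i _ => h0 i) (by positivity) ?_)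
          exact le_mul_of_one_le_right (by positivity) hN1
      _ = ((m : ENNReal) ^ 2)⁻¹ * (m * ∑' α, ENNReal.ofReal (V α / (p α).toReal)) := by
          rw [lintegral_const_mul _ (by fun_prop), lintegral_finsetSum _ fun i _ => by fun_prop]
          congr 1
          have : ∀ i : Fin m, ∫⁻ A : Fin m → MultiIndex D,
              ENNReal.ofReal (V (A i) / (p (A i)).toReal ^ 2) ∂(Measure.pi fun _ => p.toMeasure)
              = ∑' α, ENNReal.ofReal (V α / (p α).toReal) := fun i => by
            rw [(measurePreserving_eval (fun _ : Fin m => p.toMeasure) i).lintegral_comp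
              (f := fun α => ENNReal.ofReal (V α / (p α).toReal ^ 2)) (by fun_prop), lintegral_pmf]
            exact tsum_congr fun α => hofp α _ (hV α)
          simp only [this, Finset.sum_const, Finset.card_univ, Fintype.card_fin, nsmul_eq_mul]
      _ = (m : ENNReal)⁻¹ * ∑' α, ENNReal.ofReal (V α / (p α).toReal) := by
          have hm' : (m : ENNReal) ≠ 0 := by simpa using hm.ne'
          rw [← mul_assoc, sq, ENNReal.mul_inv (Or.inl hm') (Or.inl (by simp)),
            mul_assoc _ _ (m : ENNReal), ENNReal.inv_mul_cancel hm' (by simp), mul_one]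
  · have h1 := lintegral_sq_empiricalMean_sub_le hm p.toMeasure
      (g := fun α => g α / (p α).toReal) (by fun_prop) a
    have hint : ∫ α, g α / (p α).toReal ∂p.toMeasure = a := by
      have hgp : Measurable fun α => g α / (p α).toReal := by fun_prop
      have hfin := ne_top_of_le_ne_top hS.tsum_ofReal_ne_top hsq
      rw [PMF.integral_eq_tsum p _ ((memLp_two_of_lintegral_sq_ne_top hgp.aestronglyMeasurable
        hfin).integrable (by norm_num)), ← ha.tsum_eq]
      refine tsum_congr fun α => ?_
      rw [smul_eq_mul, mul_div_cancel₀ _ (hp0 α).ne']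
    rw [hint, sub_self] at h1
    simp only [ne_eq, OfNat.ofNat_ne_zero, not_false_eq_true, zero_pow, ENNReal.ofReal_zero,
      zero_add] at h1
    exact h1.trans (mul_le_mul_right hsq _)

end MeanSquare

end Problem

/-! ### Summability of product weights, and the ratio inequality. -/

/-- Every finite set of multi-indices lies in the product of its projections, over which the sum
factorises. -/
theorem summable_prod_apply {D : ℕ} {f : Fin D → ℕ → ℝ} (h0 : ∀ i k, 0 ≤ f i k)
    (hf : ∀ i, Summable (f i)) : Summable fun α : MultiIndex D => ∏ i, f i (α i) := by
  refine summable_of_sum_le (c := ∏ i, ∑' k, f i k)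
    (fun α => Finset.prod_nonneg fun i _ => h0 i _) fun s => ?_
  calc ∑ α ∈ s, ∏ i, f i (α i)
      ≤ ∑ α ∈ Fintype.piFinset fun i => s.image fun α => α i, ∏ i, f i (α i) := by
        refine Finset.sum_le_sum_of_subset_of_nonneg (fun α hα => ?_)
          fun α _ _ => Finset.prod_nonneg fun i _ => h0 i _
        exact Fintype.mem_piFinset.2 fun i => Finset.mem_image_of_mem _ hα
    _ = ∏ i, ∑ k ∈ s.image fun α => α i, f i k := (Finset.prod_univ_sum _ _).symm
    _ ≤ ∏ i, ∑' k, f i k := Finset.prod_le_prod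
        (fun i _ => Finset.sum_nonneg fun k _ => h0 i k)
        fun i _ => (hf i).sum_le_tsum _ fun k _ => h0 i k

theorem summable_prod_two_rpow {D : ℕ} {θ : Fin D → ℝ} (hθ : ∀ i, 0 < θ i) :
    Summable fun α : MultiIndex D => ∏ i, (2 : ℝ) ^ (-(α i : ℝ) * θ i) := by
  refine summable_prod_apply (f := fun i k => (2 : ℝ) ^ (-(k : ℝ) * θ i))
    (fun i k => by positivity) fun i => ?_
  have h : ∀ k : ℕ, (2 : ℝ) ^ (-(k : ℝ) * θ i) = ((2 : ℝ) ^ (-θ i)) ^ k := fun k => by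
    rw [← Real.rpow_natCast, ← Real.rpow_mul (by norm_num)]
    congr 1
    ring
  simp only [h]
  exact summable_geometric_of_lt_one (by positivity)
    (Real.rpow_lt_one_of_one_lt_of_neg (by norm_num) (by linarith [hθ i]))

/-- Normalisation of positive summable weights. -/
theorem exists_pmf_of_summable {ι : Type*} [Nonempty ι] {w : ι → ℝ} (hw : ∀ i, 0 < w i)
    (hs : Summable w) : ∃ (p : PMF ι) (c : ℝ), 0 < c ∧ ∀ i, (p i).toReal = c * w i := by
  obtain ⟨i₀⟩ := ‹Nonempty ι›
  have hS : 0 < ∑' i, w i := hs.tsum_pos (fun i => (hw i).le) i₀ (hw i₀)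
  have h0 : ∀ i, 0 ≤ (∑' i, w i)⁻¹ * w i := fun i => mul_nonneg (inv_nonneg.2 hS.le) (hw i).le
  refine ⟨⟨fun i => ENNReal.ofReal ((∑' i, w i)⁻¹ * w i), ?_⟩, (∑' i, w i)⁻¹, by positivity,
    fun i => ENNReal.toReal_ofReal (h0 i)⟩
  rw [ENNReal.summable.hasSum_iff, ← ENNReal.ofReal_tsum_of_nonneg h0 (hs.mul_left _),
    tsum_mul_left, inv_mul_cancel₀ hS.ne', ENNReal.ofReal_one]

/-- With `w = max y z`, the difference is `(x - a)/w + (a/b)(b - w)/w`. Since `z ≤ b`, truncation at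
`z` only moves `y` closer to `b`, and `w ≥ z` controls the denominators. -/
theorem sq_ratio_sub_ratio_le {x y z a b : ℝ} (hz : 0 < z) (hzb : z ≤ b) :
    (x / max y z - a / b) ^ 2
      ≤ 2 / z ^ 2 * (x - a) ^ 2 + 2 * a ^ 2 / (z ^ 2 * b ^ 2) * (y - b) ^ 2 := by
  have hb : 0 < b := hz.trans_le hzb
  have hw : z ≤ max y z := le_max_right _ _
  have hyb : (b - max y z) ^ 2 ≤ (y - b) ^ 2 := by
    rcases le_total y z with h | h
    · rw [max_eq_right h]
      nlinarith
    · rw [max_eq_left h]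
      nlinarith
  set w := max y z with hw'
  have hw0 : 0 < w := hz.trans_le hw
  have e : x / w - a / b = (x - a) / w + a / b * ((b - w) / w) := by
    field_simp
    ring
  have h1 : ((x - a) / w) ^ 2 ≤ (x - a) ^ 2 / z ^ 2 := by
    rw [div_pow]
    gcongr
  have h2 : ((b - w) / w) ^ 2 ≤ (y - b) ^ 2 / z ^ 2 := by
    rw [div_pow]
    gcongr
  calc (x / w - a / b) ^ 2
      ≤ 2 * ((x - a) / w) ^ 2 + 2 * (a / b * ((b - w) / w)) ^ 2 := by
        rw [e]
        nlinarith [sq_nonneg ((x - a) / w - a / b * ((b - w) / w))]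
    _ = 2 * ((x - a) / w) ^ 2 + 2 * (a / b) ^ 2 * ((b - w) / w) ^ 2 := by ring
    _ ≤ 2 * ((x - a) ^ 2 / z ^ 2) + 2 * (a / b) ^ 2 * ((y - b) ^ 2 / z ^ 2) := by gcongr
    _ = _ := by field_simp

theorem integrable_and_integral_le_of_lintegral_le {Ω : Type*} [MeasurableSpace Ω] {μ : Measure Ω}
    {h : Ω → ℝ} (hm : Measurable h) (h0 : ∀ ω, 0 ≤ h ω) {c : ℝ} (hc : 0 ≤ c)
    (hle : ∫⁻ ω, ENNReal.ofReal (h ω) ∂μ ≤ ENNReal.ofReal c) :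
    Integrable h μ ∧ ∫ ω, h ω ∂μ ≤ c := by
  have hi : Integrable h μ := ⟨hm.aestronglyMeasurable, by
    rw [hasFiniteIntegral_iff_ofReal (ae_of_all _ h0)]
    exact hle.trans_lt ENNReal.ofReal_lt_top⟩
  refine ⟨hi, ?_⟩
  rwa [← ofReal_integral_eq_lintegral_ofReal hi (ae_of_all _ h0),
    ENNReal.ofReal_le_ofReal_iff hc] at hle

/-! ### The balanced law, and the error and cost rates it gives. -/

namespace Problem

variable {D : ℕ} {X : Type*} [MeasurableSpace X] (P : Problem D X)

/-- The law of the multi-indices that balances variance and cost. -/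
def IsBalanced (p : PMF (MultiIndex D)) (β γ : Fin D → ℝ) : Prop :=
  ∃ c : ℝ, 0 < c ∧ ∀ α, (p α).toReal = c * ∏ i, (2 : ℝ) ^ (-(α i : ℝ) * (γ i + β i) / 2)

theorem exists_isBalanced {β γ : Fin D → ℝ} (h : ∀ i, 0 < γ i + β i) :
    ∃ p : PMF (MultiIndex D), IsBalanced p β γ := by
  have hs := summable_prod_two_rpow (θ := fun i => (γ i + β i) / 2) fun i => half_pos (h i)
  simp only [← mul_div_assoc] at hs
  obtain ⟨p, c, hc, hp⟩ := exists_pmf_of_summable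
    (fun α => Finset.prod_pos fun i _ => by positivity) hs
  exact ⟨p, c, hc, hp⟩

theorem IsBalanced.toReal_pos {p : PMF (MultiIndex D)} {β γ : Fin D → ℝ} (h : IsBalanced p β γ)
    (α : MultiIndex D) : 0 < (p α).toReal := by
  obtain ⟨c, hc, hp⟩ := h
  rw [hp]
  exact mul_pos hc (Finset.prod_pos fun i _ => by positivity)

/-- The exponent `(γ + β)/2` is the midpoint: dividing the variance rate by `p`, or multiplying the
cost rate by `p`, leaves the same decay `(β - γ)/2`. -/
theorem IsBalanced.summable_variance_div {p : PMF (MultiIndex D)} {β γ : Fin D → ℝ}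
    (h : IsBalanced p β γ) (hβγ : ∀ i, γ i < β i) :
    Summable fun α => (∏ i, (2 : ℝ) ^ (-(α i : ℝ) * β i)) / (p α).toReal := by
  obtain ⟨c, hc, hp⟩ := h
  have hs := (summable_prod_two_rpow (θ := fun i => (β i - γ i) / 2)
    fun i => half_pos (sub_pos.2 (hβγ i))).mul_left c⁻¹
  refine hs.congr fun α => ?_
  rw [hp, mul_comm c, ← div_div, ← Finset.prod_div_distrib, inv_mul_eq_div]
  congr 1
  refine Finset.prod_congr rfl fun i _ => ?_
  rw [← Real.rpow_sub (by norm_num)]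
  congr 1
  ring

theorem IsBalanced.summable_mul_cost {p : PMF (MultiIndex D)} {β γ : Fin D → ℝ}
    (h : IsBalanced p β γ) (hβγ : ∀ i, γ i < β i) :
    Summable fun α => (p α).toReal * ∏ i, (2 : ℝ) ^ ((α i : ℝ) * γ i) := by
  obtain ⟨c, hc, hp⟩ := h
  have hs := (summable_prod_two_rpow (θ := fun i => (β i - γ i) / 2)
    fun i => half_pos (sub_pos.2 (hβγ i))).mul_left c
  refine hs.congr fun α => ?_
  rw [hp, mul_assoc, ← Finset.prod_mul_distrib]
  congr 1
  refine Finset.prod_congr rfl fun i _ => ?_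
  rw [← Real.rpow_add (by norm_num)]
  congr 1
  ring

/-- The estimator of an unnormalised integral has a mean square error of order `1 / N`. -/
theorem exists_lintegral_sq_Fhat_sub_le (hG : P.BoundedPotentials) {β γ : Fin D → ℝ}
    {p : PMF (MultiIndex D)} (hp : IsBalanced p β γ) (hβγ : ∀ i, γ i < β i)
    {ζ : MultiIndex D → X → ℝ} (hζ : ∀ α, Measurable (ζ α)) (hV : P.VarianceRate ζ β) {a : ℝ}
    (hlim : Tendsto (fun α => P.fα α (ζ α)) atTop (𝓝 a)) {Nmin : ℕ} (hN : 0 < Nmin) :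
    ∃ C : ℝ, 0 ≤ C ∧ ∀ m : ℕ, 0 < m →
      ∫⁻ ω, ENNReal.ofReal ((P.Fhat p Nmin m ζ ω - a) ^ 2) ∂(P.sampleLaw p m)
        ≤ ENNReal.ofReal (C / ((m * Nmin : ℕ) : ℝ)) := by
  obtain ⟨C, hC, hb⟩ := P.exists_increment_bounds hG hζ hV
  have hp0 := hp.toReal_pos
  have hS : Summable fun α => (C * ∏ i, (2 : ℝ) ^ (-(α i : ℝ) * β i)) / (p α).toReal := by
    simpa only [mul_div_assoc] using (hp.summable_variance_div hβγ).mul_left C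
  have hpS : Summable fun α => (p α).toReal :=
    ENNReal.summable_toReal (by rw [p.tsum_coe]; exact ENNReal.one_ne_top)
  -- By `|g| p ≤ g² + p²` and `g² ≤ V`, each `|g|` is at most `V / p + p`, and both terms are
  -- summable.
  have hgS : Summable fun α => ∫ x, mixedDiff (fun a => P.Lα a x * ζ a x) α ∂P.prior := by
    refine Summable.of_norm_bounded (hS.add hpS) fun α => ?_
    have h1 := (hb α).1
    have h2 := hp0 α
    set g := ∫ x, mixedDiff (fun a => P.Lα a x * ζ a x) α ∂P.prior
    rw [Real.norm_eq_abs, div_add' _ _ _ h2.ne', le_div_iff₀ h2]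
    nlinarith [sq_abs g, abs_nonneg g, sq_nonneg (|g| - (p α).toReal)]
  -- The sum converges unconditionally, so it may be computed along boxes, whose partial sums are
  -- the approximate targets. No rate is needed.
  have hsum : HasSum (fun α => ∫ x, mixedDiff (fun a => P.Lα a x * ζ a x) α ∂P.prior) a := by
    have h1 := hgS.hasSum.comp tendsto_finset_Iic_atTop_atTop
    have h2 : Tendsto (fun b => ∑ α ∈ Finset.Iic b,
        ∫ x, mixedDiff (fun a => P.Lα a x * ζ a x) α ∂P.prior) atTop (𝓝 a) := by
      simpa only [P.sum_integral_mixedDiff hζ hV] using hlim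
    have h3 := tendsto_nhds_unique h1 h2
    exact h3 ▸ hgS.hasSum
  have hV0 : ∀ α, 0 ≤ (C * ∏ i, (2 : ℝ) ^ (-(α i : ℝ) * β i)) / (p α).toReal := fun α =>
    div_nonneg ((sq_nonneg _).trans (hb α).1) (hp0 α).le
  -- The factor `Nmin` converts `1 / m` into `1 / N`.
  refine ⟨2 * Nmin * ∑' α, (C * ∏ i, (2 : ℝ) ^ (-(α i : ℝ) * β i)) / (p α).toReal,
    mul_nonneg (by positivity) (tsum_nonneg hV0), fun m hm => ?_⟩
  refine (P.lintegral_sq_Fhat_sub_le p (fun α h0 => ?_) hN hm hζ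
    (fun α n hn => ((hb α).2 n hn).1) (fun α n hn => ((hb α).2 n hn).2.1)
    (fun α n hn => ((hb α).2 n hn).2.2) (fun α => (hb α).1) hS hsum).trans (le_of_eq ?_)
  · have := hp0 α
    simp [h0] at this
  · have hm0 : (0 : ℝ) < m := by exact_mod_cast hm
    have hN0 : (0 : ℝ) < Nmin := by exact_mod_cast hN
    rw [← ENNReal.ofReal_tsum_of_nonneg hV0 hS, ← ENNReal.ofReal_natCast m,
      ← ENNReal.ofReal_inv_of_pos hm0, ← ENNReal.ofReal_ofNat 2,
      ← ENNReal.ofReal_mul (by norm_num), ← ENNReal.ofReal_mul (by positivity)]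
    congr 1
    push_cast
    field_simp

theorem measurePreserving_draw (p : PMF (MultiIndex D)) {m : ℕ} (i : Fin m) :
    MeasurePreserving (fun ω : Sample D X m => ω.1 i) (P.sampleLaw p m) p.toMeasure :=
  (measurePreserving_eval (fun _ : Fin m => p.toMeasure) i).comp measurePreserving_fst

/-- The expected cost is of order `N`. -/
theorem exists_integral_totalCost_le {β γ : Fin D → ℝ} {p : PMF (MultiIndex D)}
    (hp : IsBalanced p β γ) (hβγ : ∀ i, γ i < β i) {cost : MultiIndex D → ℝ}
    (hcost : ∀ α, 0 ≤ cost α)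
    (hC : ∃ C : ℝ, 0 < C ∧ ∀ α, cost α ≤ C * ∏ i, (2 : ℝ) ^ ((α i : ℝ) * γ i)) (Nmin : ℕ) :
    ∃ C : ℝ, 0 ≤ C ∧ ∀ m : ℕ,
      Integrable (fun ω => totalCost cost Nmin ω.1) (P.sampleLaw p m) ∧
        ∫ ω, totalCost cost Nmin ω.1 ∂(P.sampleLaw p m) ≤ C * ((m * Nmin : ℕ) : ℝ) := by
  obtain ⟨C, hC0, hC⟩ := hC
  have hS : Summable fun α => (p α).toReal * cost α := by
    refine Summable.of_nonneg_of_le (fun α => mul_nonneg ENNReal.toReal_nonneg (hcost α))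
      (fun α => ?_) ((hp.summable_mul_cost hβγ).mul_left C)
    rw [mul_left_comm]
    exact mul_le_mul_of_nonneg_left (hC α) ENNReal.toReal_nonneg
  have hmc : Measurable cost := by fun_prop
  have hint : Integrable cost p.toMeasure := by
    refine ⟨hmc.aestronglyMeasurable, ?_⟩
    rw [hasFiniteIntegral_iff_ofReal (ae_of_all _ hcost), lintegral_pmf]
    refine lt_of_eq_of_lt (tsum_congr fun α => ?_) hS.tsum_ofReal_lt_top
    rw [ENNReal.ofReal_mul ENNReal.toReal_nonneg, ENNReal.ofReal_toReal (p.apply_ne_top α),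
      mul_comm]
  -- The constant is the mean cost of a particle at a random multi-index; the expected total cost
  -- equals it times `N`.
  refine ⟨∫ α, cost α ∂p.toMeasure, integral_nonneg hcost, fun m => ?_⟩
  simp only [totalCost_eq_sum]
  have hi : ∀ i : Fin m, Integrable (fun ω : Sample D X m => cost (ω.1 i)) (P.sampleLaw p m) :=
    fun i => ((P.measurePreserving_draw p i).integrable_comp hmc.aestronglyMeasurable).2 hint
  refine ⟨(integrable_finsetSum _ fun i _ => hi i).const_mul _, le_of_eq ?_⟩
  rw [integral_const_mul, integral_finsetSum _ fun i _ => hi i]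
  have he : ∀ i : Fin m, ∫ ω : Sample D X m, cost (ω.1 i) ∂(P.sampleLaw p m)
      = ∫ α, cost α ∂p.toMeasure := fun i => by
    rw [← (P.measurePreserving_draw p i).map_eq,
      integral_map (P.measurePreserving_draw p i).measurable.aemeasurable hmc.aestronglyMeasurable]
  simp only [he, Finset.sum_const, Finset.card_univ, Fintype.card_fin, nsmul_eq_mul]
  push_cast
  ring

end Problem

end RMISMC

/-! ### The main theorem. -/

theorem mainTheorem3 {D : ℕ} {X : Type*} [MeasurableSpace X] (P : RMISMC.Problem D X)
    -- uniform bounds on the potentials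
    (hG : P.BoundedPotentials)
    -- the quantity of interest, its approximations, and the lower bound on `Z`
    (φ : X → ℝ) (φα : RMISMC.MultiIndex D → X → ℝ)
    (hφ : Integrable (fun x => φ x * P.L x) P.prior)
    (hφα : ∀ α, Measurable (φα α))
    (Zmin : ℝ) (hZmin : 0 < Zmin) (hZ : Zmin ≤ P.Z)
    -- the discretisations converge, without any rate
    (hlim : Tendsto (fun α => P.fα α (φα α)) atTop (𝓝 (P.f φ)))
    (hlim_one : Tendsto (fun α => P.fα α 1) atTop (𝓝 (P.f 1)))
    -- variance and cost rates
    (β γ : Fin D → ℝ) (hγ : ∀ i, 0 < γ i) (hβγ : ∀ i, γ i < β i)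
    (hV : P.VarianceRate φα β) (hV_one : P.VarianceRate (fun _ _ => 1) β)
    (cost : RMISMC.MultiIndex D → ℝ) (hcost_nonneg : ∀ α, 0 ≤ cost α)
    (hC : ∃ C : ℝ, 0 < C ∧ ∀ α, cost α ≤ C * ∏ i, (2 : ℝ) ^ ((α i : ℝ) * γ i))
    -- particles per draw
    (Nmin : ℕ) (hNmin : 0 < Nmin) :
    ∃ p : PMF (RMISMC.MultiIndex D),
      (∃ c : ℝ, 0 < c ∧
        ∀ α, (p α).toReal = c * ∏ i, (2 : ℝ) ^ (-(α i : ℝ) * (γ i + β i) / 2)) ∧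
      ∃ C : ℝ, 0 < C ∧ ∀ m : ℕ, 0 < m →
        (Integrable (fun ω => (P.ratioEstimator p Nmin m Zmin φα ω - P.posterior φ) ^ 2)
            (P.sampleLaw p m) ∧
          ∫ ω, (P.ratioEstimator p Nmin m Zmin φα ω - P.posterior φ) ^ 2 ∂(P.sampleLaw p m) ≤
            C / ((m * Nmin : ℕ) : ℝ)) ∧
        (Integrable (fun ω => RMISMC.totalCost cost Nmin ω.1) (P.sampleLaw p m) ∧
          ∫ ω, RMISMC.totalCost cost Nmin ω.1 ∂(P.sampleLaw p m) ≤
            C * ((m * Nmin : ℕ) : ℝ)) := by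
  obtain ⟨p, hp⟩ := RMISMC.Problem.exists_isBalanced (β := β) (γ := γ)
    fun i => add_pos (hγ i) ((hγ i).trans (hβγ i))
  obtain ⟨C₁, hC₁, h₁⟩ := P.exists_lintegral_sq_Fhat_sub_le hG hp hβγ hφα hV hlim hNmin
  obtain ⟨C₂, hC₂, h₂⟩ := P.exists_lintegral_sq_Fhat_sub_le hG hp hβγ
    (fun _ => measurable_const) hV_one hlim_one hNmin
  obtain ⟨C₃, hC₃, h₃⟩ := P.exists_integral_totalCost_le hp hβγ hcost_nonneg hC Nmin
  set a := P.f φ with ha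
  set b := P.f 1 with hb
  have hZb : Zmin ≤ b := hZ
  have hb0 : 0 < b := hZmin.trans_le hZb
  set k₁ := 2 / Zmin ^ 2 with hk₁
  set k₂ := 2 * a ^ 2 / (Zmin ^ 2 * b ^ 2) with hk₂
  have hk₁0 : 0 ≤ k₁ := by positivity
  have hk₂0 : 0 ≤ k₂ := by positivity
  -- One constant for both claims: the first two terms bound the ratio error, `C₃` the cost, and the
  -- 1 ensures strict positivity.
  refine ⟨p, hp, k₁ * C₁ + k₂ * C₂ + C₃ + 1, by positivity, fun m hm => ⟨?_, (h₃ m).1, ?_⟩⟩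
  · have hN : (0 : ℝ) < ((m * Nmin : ℕ) : ℝ) := by exact_mod_cast Nat.mul_pos hm hNmin
    have hF := P.measurable_Fhat p Nmin m hφα
    have hF1 := P.measurable_Fhat p Nmin m (ζ := fun _ _ => 1) fun _ => measurable_const
    have hmeas : Measurable fun ω =>
        (P.ratioEstimator p Nmin m Zmin φα ω - P.posterior φ) ^ 2 := by
      unfold RMISMC.Problem.ratioEstimator
      exact ((hF.div (hF1.max measurable_const)).sub_const _).pow_const 2
    refine RMISMC.integrable_and_integral_le_of_lintegral_le hmeas (fun _ => sq_nonneg _)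
      (by positivity) ?_
    calc ∫⁻ ω, ENNReal.ofReal ((P.ratioEstimator p Nmin m Zmin φα ω - P.posterior φ) ^ 2)
          ∂(P.sampleLaw p m)
        ≤ ∫⁻ ω, (ENNReal.ofReal k₁ * ENNReal.ofReal ((P.Fhat p Nmin m φα ω - a) ^ 2)
            + ENNReal.ofReal k₂
              * ENNReal.ofReal ((P.Fhat p Nmin m (fun _ _ => 1) ω - b) ^ 2))
          ∂(P.sampleLaw p m) := by
          refine lintegral_mono fun ω => ?_
          rw [← ENNReal.ofReal_mul hk₁0, ← ENNReal.ofReal_mul hk₂0,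
            ← ENNReal.ofReal_add (by positivity) (by positivity)]
          exact ENNReal.ofReal_le_ofReal (RMISMC.sq_ratio_sub_ratio_le hZmin hZb)
      _ = ENNReal.ofReal k₁ * ∫⁻ ω, ENNReal.ofReal ((P.Fhat p Nmin m φα ω - a) ^ 2)
            ∂(P.sampleLaw p m)
          + ENNReal.ofReal k₂ * ∫⁻ ω,
            ENNReal.ofReal ((P.Fhat p Nmin m (fun _ _ => 1) ω - b) ^ 2)
            ∂(P.sampleLaw p m) := by
          rw [lintegral_add_left (by fun_prop), lintegral_const_mul _ (by fun_prop),
            lintegral_const_mul _ (by fun_prop)]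
      _ ≤ ENNReal.ofReal k₁ * ENNReal.ofReal (C₁ / ((m * Nmin : ℕ) : ℝ))
          + ENNReal.ofReal k₂ * ENNReal.ofReal (C₂ / ((m * Nmin : ℕ) : ℝ)) :=
          add_le_add (mul_le_mul_right (h₁ m hm) _) (mul_le_mul_right (h₂ m hm) _)
      _ ≤ ENNReal.ofReal ((k₁ * C₁ + k₂ * C₂ + C₃ + 1) / ((m * Nmin : ℕ) : ℝ)) := by
          rw [← ENNReal.ofReal_mul hk₁0, ← ENNReal.ofReal_mul hk₂0,
            ← ENNReal.ofReal_add (by positivity) (by positivity), ← mul_div_assoc,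
            ← mul_div_assoc, ← add_div]
          refine ENNReal.ofReal_le_ofReal (div_le_div_of_nonneg_right ?_ hN.le)
          linarith
  · refine (h₃ m).2.trans (mul_le_mul_of_nonneg_right ?_ (Nat.cast_nonneg _))
    have : 0 ≤ k₁ * C₁ + k₂ * C₂ := by positivity
    linarith
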